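/- Let $\sigma=\mathrm{diag}(-1,1,1)$ and $e^{i\lambda x\,\mathrm{ad}\,\sigma}B=e^{i\lambda x\sigma}Be^{-i\lambda x\sigma}$ for $3\times3$ matrices $B$. Let $x\in\mathbb R$, let $\rho_1,\rho_2\in H^{1,1}(\mathbb R)=\{f: f'\in L^2(\mathbb R),\ \lambda f(\lambda)\in L^2(\mathbb R)\}$ (continuous representatives), let $n\ge 0$, $z_1,\dots,z_n\in\mathbb C^+$ and $\mathbf C_1,\dots,\mathbf C_n\in\mathbb C^2$ (column vectors). Let $\gamma_i$ be the circle of radius $r_i>0$ around $z_i$, where the $r_i$ are so small that the closed discs bounded by the $\gamma_i$ lie in the open upper half-plane and are pairwise disjoint; let $\gamma_i^*$ be the complex conjugate circle, around $\overline{z_i}$. Put $\Gamma=\mathbb R\cup\bigcup_i(\gamma_i\cup\gamma_i^*)$, with $\mathbb R$ oriented from left to right, $\gamma_i$ clockwise and $\gamma_i^*$ counterclockwise, so that the positive (left) side of $\Gamma$ is the upper half-plane near $\mathbb R$, the exterior of $\gamma_i$ and the interior of $\gamma_i^*$. Define on $\Gamma$ $$V(\lambda)=\begin{pmatrix}1+|\rho_1(\lambda)|^2+|\rho_2(\lambda)|^2&\overline{\rho_1(\lambda)}&\overline{\rho_2(\lambda)}\\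 \rho_1(\lambda)&1&0\\ \rho_2(\lambda)&0&1\end{pmatrix}\ (\lambda\in\mathbb R),$$ $$V(\lambda)=\begin{pmatrix}1&0\\ \frac{\mathbf C_i}{\lambda-z_i}&I_2\end{pmatrix}\ (\lambda\in\gamma_i),\qquad V(\lambda)=\begin{pmatrix}1&\frac{\overline{\mathbf C_i}^{\,T}}{\lambda-\overline{z_i}}\\ 0&I_2\end{pmatrix}\ (\lambda\in\gamma_i^*).$$ Then there is exactly one $3\times3$ matrix-valued function $M(x,\cdot)$ on $\mathbb C\setminus\Gamma$ such that (i) $M(x,z)$ is analytic in $z\in\mathbb C\setminus\Gamma$; (ii) $M(x,z)\to I$ as $z\to\infty$ in $\mathbb C\setminus\Gamma$, and, for every $\delta>0$, $M(x,z)=I+\mathcal O(z^{-1})$ as $z\to\infty$ in $\{|\operatorname{Im}z|\ge\delta\}$; (iii) at each $\lambda\in\Gamma$, $M(x,\cdot)$ has boundary values $M_+(x,\lambda)$ and $M_-(x,\lambda)$ (limits as $z\to\lambda$ from the positive and from the negative side of $\Gamma$), which are continuous on $\Gamma$ and satisfy $$M_+(x,\lambda)=M_-(x,\lambda)\,e^{i\lambda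 x\,\mathrm{ad}\,\sigma}V(\lambda).$$ -/

import Mathlib

open Complex Filter Topology MeasureTheory Bornology Asymptotics Set
open scoped ComplexConjugate

namespace ManakovRHP

/-- The weighted Sobolev space `H^{1,1}(ℝ) = {f : f' ∈ L², λ f ∈ L²}`, in terms of the (absolutely)
continuous representative `f`: the function `f` is a primitive of some `g ∈ L²(ℝ)`, its weak
derivative, and `λ ↦ λ f(λ)` is in `L²(ℝ)`. Both together give `f ∈ L²(ℝ)`. -/
def MemH11 (f : ℝ → ℂ) : Prop :=
  (∃ g : ℝ → ℂ, MemLp g 2 volume ∧ ∀ a b : ℝ, f b - f a = ∫ t in a..b, g t) ∧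
    MemLp (fun t : ℝ => (t : ℂ) * f t) 2 volume

/-- The diagonal entries of `σ = diag(-1, 1, 1)`. -/
def sig : Fin 3 → ℂ := ![-1, 1, 1]

/-- The diagonal matrix `e^{i λ x σ}`. -/
noncomputable def expSig (x : ℝ) (l : ℂ) : Matrix (Fin 3) (Fin 3) ℂ :=
  Matrix.diagonal fun j => Complex.exp (I * l * x * sig j)

/-- `e^{i λ x ad σ} B = e^{i λ x σ} B e^{-i λ x σ}`, where `ad σ (B) = σ B - B σ`. -/
noncomputable def expAd (x : ℝ) (l : ℂ) (B : Matrix (Fin 3) (Fin 3) ℂ) :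
    Matrix (Fin 3) (Fin 3) ℂ :=
  expSig x l * B * expSig x (-l)

/-- The jump matrix on the real line, in terms of the values `a = ρ₁(λ)` and `b = ρ₂(λ)`. -/
noncomputable def jumpReal (a b : ℂ) : Matrix (Fin 3) (Fin 3) ℂ :=
  !![1 + ((‖a‖ ^ 2 : ℝ) : ℂ) + ((‖b‖ ^ 2 : ℝ) : ℂ), conj a, conj b;
     a, 1, 0;
     b, 0, 1]

/-- The jump matrix on the circle `γ` around `w` in the upper half plane, with constant vector
`c`. -/
noncomputable def jumpUp (w : ℂ) (c : Fin 2 → ℂ) (l : ℂ) : Matrix (Fin 3) (Fin 3) ℂ :=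
  !![1, 0, 0;
     c 0 / (l - w), 1, 0;
     c 1 / (l - w), 0, 1]

/-- The jump matrix on the reflected circle `γ*` around `w*`. -/
noncomputable def jumpDown (w : ℂ) (c : Fin 2 → ℂ) (l : ℂ) : Matrix (Fin 3) (Fin 3) ℂ :=
  !![1, conj (c 0) / (l - conj w), conj (c 1) / (l - conj w);
     0, 1, 0;
     0, 0, 1]

/-- The contour `Γ`: the real line, the circles `|λ - z_i| = r_i` and their conjugates. -/
def contour {n : ℕ} (z : Fin n → ℂ) (r : Fin n → ℝ) : Set ℂ :=
  {l | l.im = 0} ∪ (⋃ i, Metric.sphere (z i) (r i)) ∪ ⋃ i, Metric.sphere (conj (z i)) (r i)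

/-- The positive side of `Γ`. The real line is oriented from left to right, the circles in the
upper half plane are oriented clockwise, those in the lower half plane counterclockwise; the
positive side lies to the left. -/
def plusSide {n : ℕ} (z : Fin n → ℂ) (r : Fin n → ℝ) : Set ℂ :=
  {w | 0 < w.im ∧ ∀ i, r i < dist w (z i)} ∪ ⋃ i, Metric.ball (conj (z i)) (r i)

/-- The negative side of `Γ`, to the right of the oriented contour. -/
def minusSide {n : ℕ} (z : Fin n → ℂ) (r : Fin n → ℝ) : Set ℂ :=
  {w | w.im < 0 ∧ ∀ i, r i < dist w (conj (z i))} ∪ ⋃ i, Metric.ball (z i) (r i)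

/-- `M` (of which only the values off the contour `Γ` matter) solves the Riemann–Hilbert problem
with parameter `x`, reflection coefficients `ρ₁, ρ₂`, poles `z_i`, radii `r_i` and constants
`C_i ∈ ℂ²`. -/
structure IsSolution {n : ℕ} (x : ℝ) (ρ₁ ρ₂ : ℝ → ℂ) (z : Fin n → ℂ) (r : Fin n → ℝ)
    (C : Fin n → Fin 2 → ℂ) (M : ℂ → Matrix (Fin 3) (Fin 3) ℂ) : Prop where
  /-- `M` is analytic off `Γ`. -/
  analytic : ∀ i j, DifferentiableOn ℂ (fun w => M w i j) (contour z r)ᶜ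
  /-- `M → I` as `z → ∞` in the complement of `Γ`, uniformly up to the contour. -/
  tendsto_one : Tendsto M (cobounded ℂ ⊓ 𝓟 (contour z r)ᶜ) (𝓝 1)
  /-- `M = I + O(1/z)` as `z → ∞`, uniformly in `|Im z| ≥ δ`, for every `δ > 0`. -/
  isBigO : ∀ δ : ℝ, 0 < δ → ∀ i j,
    (fun w => M w i j - (1 : Matrix (Fin 3) (Fin 3) ℂ) i j)
      =O[cobounded ℂ ⊓ 𝓟 {w | δ ≤ |w.im|}] fun w => w⁻¹
  /-- `M` has continuous boundary values on `Γ` from both sides, related by the jump matrix. -/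
  jump : ∃ Mp Mm : ℂ → Matrix (Fin 3) (Fin 3) ℂ,
    ContinuousOn Mp (contour z r) ∧ ContinuousOn Mm (contour z r) ∧
    (∀ l ∈ contour z r, Tendsto M (𝓝[plusSide z r] l) (𝓝 (Mp l))) ∧
    (∀ l ∈ contour z r, Tendsto M (𝓝[minusSide z r] l) (𝓝 (Mm l))) ∧
    (∀ t : ℝ, Mp t = Mm t * expAd x t (jumpReal (ρ₁ t) (ρ₂ t))) ∧
    (∀ i, ∀ l ∈ Metric.sphere (z i) (r i), Mp l = Mm l * expAd x l (jumpUp (z i) (C i) l)) ∧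
    (∀ i, ∀ l ∈ Metric.sphere (conj (z i)) (r i),
      Mp l = Mm l * expAd x l (jumpDown (z i) (C i) l))

end ManakovRHP

/-!
Uniqueness. Every jump matrix has determinant `1`. If `M` and `M'` are two solutions, then neither
`det M` nor `M' * M.adjugate` jumps across `Γ`; both extend to entire functions tending to the
identity at infinity, so both are constant by Liouville's theorem and `M' = M`.

Existence. Multiplying by triangular unipotent factors inside the circles, and compensating for
their poles outside, removes the circles from `Γ`. What is left is a problem on the real line whose
reflection coefficients are the functions `e^{2iλx} ρ_k` up to correction terms which are again
regular. Writing the two sides of the solution as one-sided Fourier integrals turns this problem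
into a Marchenko equation on `L²(0, ∞)` with the operator `1 + ∑ H_k H_k^*`, where the `H_k` are
Hankel operators. The operator is bounded below by the identity, hence invertible. Its solutions are
integrable by Hardy's inequality, which makes the boundary values continuous.
-/

namespace ManakovRHP

open scoped FourierTransform InnerProductSpace Function

lemma eLpNorm_two_sq {α E : Type*} [MeasurableSpace α] [NormedAddCommGroup E] (μ : Measure α)
    (f : α → E) : eLpNorm f 2 μ ^ 2 = ∫⁻ a, ‖f a‖ₑ ^ 2 ∂μ := by
  simpa using eLpNorm_nnreal_pow_eq_lintegral (f := f) (μ := μ) (two_ne_zero (α := NNReal))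

section Plancherel

variable {V E : Type*} [NormedAddCommGroup V] [InnerProductSpace ℝ V] [FiniteDimensional ℝ V]
  [MeasurableSpace V] [BorelSpace V] [NormedAddCommGroup E] {f g : V → E}

lemma continuous_fourier [NormedSpace ℂ E] (hf : Integrable f) : Continuous (𝓕 f) :=
  VectorFourier.fourierIntegral_continuous Real.continuous_fourierChar continuous_inner hf

lemma fourier_add [NormedSpace ℂ E] (hf : Integrable f) (hg : Integrable g) :
    𝓕 (f + g) = 𝓕 f + 𝓕 g :=
  VectorFourier.fourierIntegral_add Real.continuous_fourierChar continuous_inner hf hg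

lemma fourier_const_smul [NormedSpace ℂ E] (c : ℂ) (f : V → E) : 𝓕 (c • f) = c • 𝓕 f :=
  VectorFourier.fourierIntegral_const_smul _ _ _ f c

lemma fourier_comp_add_right [NormedSpace ℂ E] (f : V → E) (h s : V) :
    𝓕 (fun v => f (v + h)) s = Real.fourierChar (inner ℝ h s) • 𝓕 f s :=
  congrFun (VectorFourier.fourierIntegral_comp_add_right _ _ _ f h) s

lemma integral_fourier_smul_eq [NormedSpace ℂ E] [CompleteSpace E] {φ : V → ℂ} (hφ : Integrable φ)
    (hf : Integrable f) :
    ∫ v, 𝓕 φ v • f v = ∫ v, φ v • 𝓕 f v := by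
  have := VectorFourier.integral_fourierIntegral_smul_eq_flip (L := innerₗ V)
    Real.continuous_fourierChar continuous_inner hφ hf
  rwa [flip_innerₗ] at this

variable [InnerProductSpace ℂ E] [CompleteSpace E]

lemma fourier_toLp_ae_eq (hf : Integrable f) (hf2 : MemLp f 2 volume) :
    (𝓕 (hf2.toLp f) : Lp E 2 (volume : Measure V)) =ᵐ[volume] 𝓕 f := by
  refine ae_eq_of_integral_contDiff_smul_eq ((Lp.memLp _).locallyIntegrable (by norm_num))
    (continuous_fourier hf).locallyIntegrable fun φ hφ hφc => ?_
  let Φ : SchwartzMap V ℂ := HasCompactSupport.toSchwartzMap (f := fun v => (φ v : ℂ))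
    (hφc.comp_left (g := ((↑) : ℝ → ℂ)) ofReal_zero) (ofRealCLM.contDiff.comp hφ)
  have hΦ (v : V) (u : E) : Φ v • u = φ v • u := RCLike.real_smul_eq_coe_smul (φ v) u |>.symm
  have duality := congrArg (· Φ) (Lp.fourier_toTemperedDistribution_eq (hf2.toLp f))
  simp only [TemperedDistribution.fourier_apply, Lp.toTemperedDistribution_apply] at duality
  calc ∫ v, φ v • (𝓕 (hf2.toLp f) : Lp E 2 (volume : Measure V)) v
      = ∫ v, Φ v • (𝓕 (hf2.toLp f) : Lp E 2 (volume : Measure V)) v := by simp only [hΦ]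
    _ = ∫ v, (𝓕 Φ) v • (hf2.toLp f) v := duality.symm
    _ = ∫ v, 𝓕 (Φ : V → ℂ) v • f v := by
        refine integral_congr_ae ?_
        filter_upwards [hf2.coeFn_toLp] with v hv
        rw [hv, SchwartzMap.fourier_coe]
    _ = ∫ v, Φ v • 𝓕 f v := integral_fourier_smul_eq Φ.integrable hf
    _ = ∫ v, φ v • 𝓕 f v := by simp only [hΦ]

lemma eLpNorm_fourier (hf : Integrable f) (hf2 : MemLp f 2 volume) :
    eLpNorm (𝓕 f) 2 volume = eLpNorm f 2 volume := by
  rw [← eLpNorm_congr_ae (fourier_toLp_ae_eq hf hf2), ← Lp.enorm_def, ← ofReal_norm,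
    Lp.norm_fourier_eq, ofReal_norm, Lp.enorm_toLp]

lemma lintegral_enorm_fourier_sq (hf : Integrable f) (hf2 : MemLp f 2 volume) :
    ∫⁻ v, ‖𝓕 f v‖ₑ ^ 2 = ∫⁻ v, ‖f v‖ₑ ^ 2 := by
  rw [← eLpNorm_two_sq, eLpNorm_fourier hf hf2, eLpNorm_two_sq]

end Plancherel

section WeightedL2

variable {E F : Type*} [NormedAddCommGroup E] [NormedAddCommGroup F] {f g : ℝ → E}

lemma memLp_inv_one_add_abs : MemLp (fun t : ℝ => (1 + |t|)⁻¹) 2 volume := by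
  have continuous_inv : Continuous fun t : ℝ => (1 + |t|)⁻¹ :=
    (by fun_prop : Continuous fun t : ℝ => 1 + |t|).inv₀ fun t => by positivity
  refine (memLp_two_iff_integrable_sq continuous_inv.aestronglyMeasurable).2 ?_
  refine (integrable_one_add_norm (E := ℝ) (μ := volume) (r := 2) (by simp)).congr
    (ae_of_all _ fun t => ?_)
  simp [Real.rpow_neg (by positivity : (0 : ℝ) ≤ 1 + |t|)]

lemma memLp_of_norm_le_inv_one_add_abs (hf : Continuous f) {c : ℝ}
    (hc : ∀ t, ‖f t‖ ≤ c * (1 + |t|)⁻¹) : MemLp f 2 volume :=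
  (memLp_inv_one_add_abs.const_mul c).mono hf.aestronglyMeasurable
    (ae_of_all _ fun t => (hc t).trans (le_abs_self _))

variable [NormedSpace ℝ E] [NormedSpace ℝ F]

/-- A continuous function with `(1 + |t|) f ∈ L²(ℝ)`: the part of `H^{1,1}(ℝ)` that survives the
Fourier transform. Such functions are both integrable and square integrable. -/
structure IsWeightedL2 (f : ℝ → E) : Prop where
  continuous : Continuous f
  memLp_smul : MemLp (fun t : ℝ => (1 + |t|) • f t) 2 volume

namespace IsWeightedL2

lemma integrable (hf : IsWeightedL2 f) : Integrable f := by
  refine (memLp_inv_one_add_abs.integrable_mul hf.memLp_smul.norm).mono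
    hf.continuous.aestronglyMeasurable (ae_of_all _ fun t => ?_)
  have pos : 0 < 1 + |t| := by positivity
  simp [norm_smul, abs_of_pos pos, pos.ne']

lemma of_norm_le {u : ℝ → F} (hf : IsWeightedL2 f) (hu : Continuous u) (c : ℝ)
    (hc : ∀ t, ‖u t‖ ≤ c * ‖f t‖) : IsWeightedL2 u := by
  refine ⟨hu, hf.memLp_smul.of_le_mul (c := c)
    (by fun_prop : Continuous fun t : ℝ => (1 + |t|) • u t).aestronglyMeasurable
    (ae_of_all _ fun t => ?_)⟩
  rw [norm_smul, norm_smul, mul_left_comm]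
  gcongr
  exact hc t

lemma memLp (hf : IsWeightedL2 f) : MemLp f 2 volume :=
  hf.memLp_smul.mono hf.continuous.aestronglyMeasurable <| ae_of_all _ fun t => by
    rw [norm_smul, Real.norm_of_nonneg (by positivity)]
    exact le_mul_of_one_le_left (norm_nonneg _) (by simp)

lemma of_memLp_smul (hf : Continuous f) (h : MemLp (fun t : ℝ => t • f t) 2 volume) :
    IsWeightedL2 f := by
  have weighted_continuous : Continuous fun t : ℝ => (1 + |t|) • f t := by fun_prop
  refine ⟨hf, (memLp_two_iff_integrable_sq_norm weighted_continuous.aestronglyMeasurable).2 ?_⟩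
  refine (by fun_prop : Continuous fun t : ℝ => ‖(1 + |t|) • f t‖ ^ 2).locallyIntegrable
    |>.integrable_of_isBigO_cocompact (IsBigO.of_bound 4 ?_)
    (((memLp_two_iff_integrable_sq_norm h.aestronglyMeasurable).1 h).integrableAtFilter _)
  filter_upwards [tendsto_norm_cocompact_atTop.eventually_ge_atTop (1 : ℝ)] with t ht
  rw [Real.norm_eq_abs] at ht
  simp only [norm_smul, norm_pow, norm_mul, Real.norm_eq_abs, mul_pow, ← mul_assoc,
    abs_abs, abs_of_nonneg (by positivity : (0 : ℝ) ≤ 1 + |t|)]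
  gcongr
  nlinarith

lemma add (hf : IsWeightedL2 f) (hg : IsWeightedL2 g) : IsWeightedL2 (f + g) :=
  ⟨hf.continuous.add hg.continuous, by
    simpa only [Pi.add_def, smul_add] using hf.memLp_smul.add hg.memLp_smul⟩

lemma comp_neg (hf : IsWeightedL2 f) : IsWeightedL2 fun t => f (-t) :=
  ⟨hf.continuous.comp continuous_neg, by
    simpa only [Function.comp_def, abs_neg] using
      hf.memLp_smul.comp_measurePreserving (Measure.measurePreserving_neg volume)⟩

lemma comp_add_right (hf : IsWeightedL2 f) (a : ℝ) : IsWeightedL2 fun t => f (t + a) := by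
  have shifted := hf.memLp_smul.comp_measurePreserving (measurePreserving_add_right volume a)
  have shift_continuous : Continuous fun t => f (t + a) :=
    hf.continuous.comp (continuous_add_const a)
  refine ⟨shift_continuous, shifted.of_le_mul (c := 1 + |a|)
    ((continuous_const.add continuous_abs).smul shift_continuous).aestronglyMeasurable
    (ae_of_all _ fun t => ?_)⟩
  have abs_le : |t| ≤ |t + a| + |a| := by simpa using abs_sub (t + a) a
  simp only [Function.comp_apply, norm_smul, Real.norm_eq_abs, ← mul_assoc,
    abs_of_nonneg (by positivity : 0 ≤ 1 + |t|), abs_of_nonneg (by positivity : 0 ≤ 1 + |t + a|)]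
  gcongr
  nlinarith [abs_nonneg a, abs_nonneg (t + a)]

end IsWeightedL2

end WeightedL2

section Sobolev

variable {E : Type*} [NormedAddCommGroup E]

lemma intervalIntegrable_of_memLp_two {g : ℝ → E} (hg : MemLp g 2 volume) (a b : ℝ) :
    IntervalIntegrable g volume a b :=
  ((hg.locallyIntegrable (by norm_num)).integrableOn_isCompact isCompact_uIcc).intervalIntegrable

lemma continuous_of_sub_eq_integral [NormedSpace ℝ E] {f g : ℝ → E} (hg : MemLp g 2 volume)
    (hfg : ∀ a b, f b - f a = ∫ t in a..b, g t) : Continuous f :=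
  (continuous_const.add (intervalIntegral.continuous_primitive
    (intervalIntegrable_of_memLp_two hg) 0)).congr fun b =>
      (eq_add_of_sub_eq' (hfg 0 b)).symm

lemma enorm_integral_sq_le {α : Type*} [MeasurableSpace α] {μ : Measure α} [NormedSpace ℝ E]
    {g : α → E} (hg : AEStronglyMeasurable g μ) :
    ‖∫ a, g a ∂μ‖ₑ ^ 2 ≤ μ univ * ∫⁻ a, ‖g a‖ₑ ^ 2 ∂μ := by
  calc ‖∫ a, g a ∂μ‖ₑ ^ 2 ≤ eLpNorm g 1 μ ^ 2 := by
        gcongr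
        exact (enorm_integral_le_lintegral_enorm g).trans_eq eLpNorm_one_eq_lintegral_enorm.symm
    _ ≤ (eLpNorm g 2 μ * μ univ ^ (1 / 2 : ℝ)) ^ 2 := by
        gcongr
        convert eLpNorm_le_eLpNorm_mul_rpow_measure_univ (p := 1) (q := 2) (by norm_num) hg using 3
        norm_num
    _ = μ univ * ∫⁻ a, ‖g a‖ₑ ^ 2 ∂μ := by
        rw [mul_pow, eLpNorm_two_sq, mul_comm, ← ENNReal.rpow_mul_natCast]
        norm_num

lemma lintegral_enorm_comp_add_sub_sq_le [NormedSpace ℝ E] {f g : ℝ → E} (hg : MemLp g 2 volume)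
    (hfg : ∀ a b, f b - f a = ∫ t in a..b, g t) {h : ℝ} (hh : 0 ≤ h) :
    ∫⁻ t, ‖f (t + h) - f t‖ₑ ^ 2 ≤ ENNReal.ofReal h ^ 2 * ∫⁻ t, ‖g t‖ₑ ^ 2 := by
  have shift_measurable (t : ℝ) : AEStronglyMeasurable (fun u => g (t + u)) volume :=
    hg.aestronglyMeasurable.comp_measurePreserving (measurePreserving_add_left volume t)
  have pointwise (t : ℝ) : ‖f (t + h) - f t‖ₑ ^ 2 ≤
      ENNReal.ofReal h * ∫⁻ u in Ioc 0 h, ‖g (t + u)‖ₑ ^ 2 := by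
    have increment : f (t + h) - f t = ∫ u in Ioc 0 h, g (t + u) := by
      rw [hfg, ← intervalIntegral.integral_of_le hh, intervalIntegral.integral_comp_add_left,
        add_zero]
    rw [increment]
    simpa using enorm_integral_sq_le ((shift_measurable t).restrict (s := Ioc 0 h))
  have sum_measurable : AEMeasurable (Function.uncurry fun t u : ℝ => ‖g (t + u)‖ₑ ^ 2)
      (volume.prod (volume.restrict (Ioc 0 h))) :=
    ((hg.aestronglyMeasurable.enorm.comp_quasiMeasurePreserving
      (quasiMeasurePreserving_add volume volume)).pow_const 2).mono_measure
        (Measure.prod_mono le_rfl Measure.restrict_le_self)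
  calc ∫⁻ t, ‖f (t + h) - f t‖ₑ ^ 2
      ≤ ∫⁻ t, ENNReal.ofReal h * ∫⁻ u in Ioc 0 h, ‖g (t + u)‖ₑ ^ 2 := lintegral_mono pointwise
    _ = ENNReal.ofReal h * ∫⁻ u in Ioc 0 h, ∫⁻ t, ‖g (t + u)‖ₑ ^ 2 := by
        rw [lintegral_const_mul' _ _ ENNReal.ofReal_ne_top, lintegral_lintegral_swap sum_measurable]
    _ = ENNReal.ofReal h ^ 2 * ∫⁻ t, ‖g t‖ₑ ^ 2 := by
        simp only [lintegral_add_right_eq_self (fun t => ‖g t‖ₑ ^ 2), setLIntegral_const,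
          Real.volume_Ioc, sub_zero]
        ring

lemma four_mul_abs_le_norm_fourierChar_sub_one {u : ℝ} (hu : |u| ≤ 1 / 2) :
    4 * |u| ≤ ‖(Real.fourierChar u : ℂ) - 1‖ := by
  have chord : ‖(Real.fourierChar u : ℂ) - 1‖ = 2 * |Real.sin (Real.pi * u)| := by
    rw [Real.fourierChar_apply, mul_comm, norm_exp_I_mul_ofReal_sub_one, norm_mul,
      Real.norm_two, Real.norm_eq_abs]
    ring_nf
  have jordan := Real.mul_abs_le_abs_sin (x := Real.pi * u) (by
    rw [abs_mul, abs_of_pos Real.pi_pos]; nlinarith [Real.pi_pos])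
  rw [abs_mul, abs_of_pos Real.pi_pos, ← mul_assoc, div_mul_cancel₀ _ Real.pi_ne_zero] at jordan
  rw [chord]
  linarith

variable [InnerProductSpace ℂ E] [CompleteSpace E] {f g : ℝ → E}

lemma setLIntegral_enorm_smul_fourier_sq_le (hf : Integrable f) (hf2 : MemLp f 2 volume)
    (hg : MemLp g 2 volume) (hfg : ∀ a b, f b - f a = ∫ t in a..b, g t) {R : ℝ} (hR : 0 < R) :
    ∫⁻ s in Icc (-R) R, ‖s • 𝓕 f s‖ₑ ^ 2 ≤ ∫⁻ t, ‖g t‖ₑ ^ 2 := by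
  set h : ℝ := (2 * R)⁻¹ with h_def
  have h_pos : 0 < h := by positivity
  have fourier_increment (s : ℝ) :
      𝓕 ((fun t => f (t + h)) - f) s = ((Real.fourierChar (s * h) : ℂ) - 1) • 𝓕 f s := by
    rw [sub_eq_add_neg, ← neg_one_smul ℂ f,
      fourier_add (hf.comp_add_right h) (hf.smul (-1 : ℂ)), fourier_const_smul, Pi.add_apply,
      Pi.smul_apply, fourier_comp_add_right, neg_one_smul, sub_smul, one_smul, ← sub_eq_add_neg]
    rfl
  have lower (s : ℝ) (hs : s ∈ Icc (-R) R) :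
      ENNReal.ofReal h ^ 2 * ‖s • 𝓕 f s‖ₑ ^ 2 ≤ ‖𝓕 ((fun t => f (t + h)) - f) s‖ₑ ^ 2 := by
    have small : |s * h| ≤ 1 / 2 := by
      rw [abs_mul, abs_of_pos h_pos, h_def, ← div_eq_mul_inv, div_le_iff₀ (by positivity)]
      linarith [abs_le.2 hs]
    rw [fourier_increment, ← mul_pow]
    gcongr
    rw [← ofReal_norm, ← ofReal_norm, ← ENNReal.ofReal_mul h_pos.le]
    gcongr
    rw [norm_smul, norm_smul, ← mul_assoc, Real.norm_eq_abs]
    gcongr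
    have := four_mul_abs_le_norm_fourierChar_sub_one small
    rw [abs_mul, abs_of_pos h_pos] at this
    nlinarith [abs_nonneg s]
  refine (ENNReal.mul_le_mul_iff_right (a := ENNReal.ofReal h ^ 2) (by positivity)
    (by finiteness)).1 ?_
  calc ENNReal.ofReal h ^ 2 * ∫⁻ s in Icc (-R) R, ‖s • 𝓕 f s‖ₑ ^ 2
      ≤ ∫⁻ s in Icc (-R) R, ‖𝓕 ((fun t => f (t + h)) - f) s‖ₑ ^ 2 := by
        rw [← lintegral_const_mul' _ _ (by finiteness)]
        exact setLIntegral_mono' measurableSet_Icc lower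
    _ ≤ ∫⁻ s, ‖𝓕 ((fun t => f (t + h)) - f) s‖ₑ ^ 2 := setLIntegral_le_lintegral _ _
    _ = ∫⁻ t, ‖f (t + h) - f t‖ₑ ^ 2 := lintegral_enorm_fourier_sq ((hf.comp_add_right h).sub hf)
        ((hf2.comp_measurePreserving (measurePreserving_add_right volume h)).sub hf2)
    _ ≤ ENNReal.ofReal h ^ 2 * ∫⁻ t, ‖g t‖ₑ ^ 2 :=
        lintegral_enorm_comp_add_sub_sq_le hg hfg h_pos.le

lemma memLp_smul_fourier (hf : Integrable f) (hf2 : MemLp f 2 volume)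
    (hg : MemLp g 2 volume) (hfg : ∀ a b, f b - f a = ∫ t in a..b, g t) :
    MemLp (fun s : ℝ => s • 𝓕 f s) 2 volume := by
  have continuous_smul : Continuous fun s : ℝ => s • 𝓕 f s := by
    have := continuous_fourier hf
    fun_prop
  have exhaust := (aecover_Icc tendsto_neg_atTop_atBot tendsto_id)
    |>.lintegral_tendsto_of_countably_generated (μ := volume)
      (continuous_smul.enorm.measurable.pow_const 2).aemeasurable
  have bound : ∫⁻ s, ‖s • 𝓕 f s‖ₑ ^ 2 ≤ ∫⁻ t, ‖g t‖ₑ ^ 2 :=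
    le_of_tendsto exhaust <| (eventually_gt_atTop 0).mono fun R hR =>
      setLIntegral_enorm_smul_fourier_sq_le hf hf2 hg hfg hR
  rw [← eLpNorm_two_sq, ← eLpNorm_two_sq] at bound
  exact ⟨continuous_smul.aestronglyMeasurable,
    ((ENNReal.pow_le_pow_left_iff two_ne_zero).1 bound).trans_lt hg.2⟩

end Sobolev

section Regular

variable {f g : ℝ → ℂ}

/-- Functions which together with their Fourier transform are continuous and square integrable
with weight `1 + |t|`: the description of `H^{1,1}(ℝ)` that is symmetric under the Fourier
transform. -/
structure IsRegular (f : ℝ → ℂ) : Prop where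
  weighted : IsWeightedL2 f
  weighted_fourier : IsWeightedL2 (𝓕 f)

lemma fourier_modulate (f : ℝ → ℂ) (x s : ℝ) :
    𝓕 (fun t : ℝ => exp (2 * I * x * t) * f t) s = 𝓕 f (s - x / Real.pi) := by
  simp only [Real.fourier_real_eq_integral_exp_smul, smul_eq_mul, ← mul_assoc, ← exp_add]
  have pi_ne_zero : (Real.pi : ℂ) ≠ 0 := by exact_mod_cast Real.pi_ne_zero
  congr with t
  push_cast
  field_simp
  ring_nf

lemma fourier_conj (f : ℝ → ℂ) (s : ℝ) : 𝓕 (fun t => conj (f t)) s = conj (𝓕 f (-s)) := by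
  simp only [Real.fourier_real_eq_integral_exp_smul, smul_eq_mul, ← integral_conj, map_mul,
    ← exp_conj, conj_I, conj_ofReal]
  congr with t
  push_cast
  ring_nf

lemma fourier_comp_neg (f : ℝ → ℂ) : 𝓕 (fun t => f (-t)) = fun s => 𝓕 f (-s) :=
  funext fun s => Real.fourier_comp_linearIsometry (LinearIsometryEquiv.neg ℝ) f s

lemma continuous_of_memH11 (hf : MemH11 f) : Continuous f :=
  let ⟨⟨_, hg, hfg⟩, _⟩ := hf
  continuous_of_sub_eq_integral hg hfg

namespace IsRegular

lemma of_memH11 (hf : MemH11 f) : IsRegular f := by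
  have weighted : IsWeightedL2 f := .of_memLp_smul (continuous_of_memH11 hf) hf.2
  obtain ⟨⟨g, hg, hfg⟩, -⟩ := hf
  exact ⟨weighted, .of_memLp_smul (continuous_fourier weighted.integrable)
    (memLp_smul_fourier weighted.integrable weighted.memLp hg hfg)⟩

lemma add (hf : IsRegular f) (hg : IsRegular g) : IsRegular (f + g) :=
  ⟨hf.weighted.add hg.weighted, by
    simpa only [fourier_add hf.weighted.integrable hg.weighted.integrable] using
      hf.weighted_fourier.add hg.weighted_fourier⟩

lemma const_smul (hf : IsRegular f) (c : ℂ) : IsRegular (c • f) :=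
  ⟨hf.weighted.of_norm_le (hf.weighted.continuous.const_smul c) ‖c‖ fun t => norm_smul_le c (f t),
    by
    rw [fourier_const_smul]
    exact hf.weighted_fourier.of_norm_le (hf.weighted_fourier.continuous.const_smul c) ‖c‖
      fun s => norm_smul_le c (𝓕 f s)⟩

lemma zero : IsRegular 0 := by
  have weighted_zero : IsWeightedL2 (0 : ℝ → ℂ) := ⟨continuous_zero, by simp⟩
  have fourier_zero : 𝓕 (0 : ℝ → ℂ) = 0 := by simpa using fourier_const_smul 0 (0 : ℝ → ℂ)
  exact ⟨weighted_zero, fourier_zero.symm ▸ weighted_zero⟩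

lemma sum {ι : Type*} (S : Finset ι) {f : ι → ℝ → ℂ} (hf : ∀ i ∈ S, IsRegular (f i)) :
    IsRegular (∑ i ∈ S, f i) :=
  Finset.sum_induction f IsRegular (fun _ _ => add) zero hf

lemma comp_neg (hf : IsRegular f) : IsRegular fun t => f (-t) :=
  ⟨hf.weighted.comp_neg, by simpa only [fourier_comp_neg] using hf.weighted_fourier.comp_neg⟩

lemma modulate (hf : IsRegular f) (x : ℝ) :
    IsRegular fun t : ℝ => exp (2 * I * x * t) * f t := by
  have unimodular (t : ℝ) : ‖exp (2 * I * x * t)‖ = 1 := by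
    simpa [mul_comm, mul_left_comm] using norm_exp_ofReal_mul_I (2 * x * t)
  refine ⟨hf.weighted.of_norm_le (by have := hf.weighted.continuous; fun_prop) 1 (by
    simp [unimodular]), ?_⟩
  simpa only [funext (fourier_modulate f x), sub_eq_add_neg] using
    hf.weighted_fourier.comp_add_right (-(x / Real.pi))

end IsRegular

lemma IsRegular.conj (hf : IsRegular f) : IsRegular fun t => conj (f t) :=
  ⟨hf.weighted.of_norm_le (continuous_conj.comp hf.weighted.continuous) 1 (by simp), by
    rw [funext (fourier_conj f)]
    exact hf.weighted_fourier.comp_neg.of_norm_le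
      (continuous_conj.comp hf.weighted_fourier.comp_neg.continuous) 1 (by simp)⟩

end Regular

section Pole

variable {w : ℂ}

lemma ofReal_sub_ne_zero (hw : w.im ≠ 0) (t : ℝ) : (t : ℂ) - w ≠ 0 := fun h =>
  hw (by simpa using congrArg im h)

lemma norm_inv_ofReal_sub_le (hw : w.im ≠ 0) (t : ℝ) :
    ‖((t : ℂ) - w)⁻¹‖ ≤ (1 + (1 + ‖w‖) / |w.im|) * (1 + |t|)⁻¹ := by
  have im_le : |w.im| ≤ ‖(t : ℂ) - w‖ := by simpa using abs_im_le_norm ((t : ℂ) - w)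
  have abs_le : |t| ≤ ‖(t : ℂ) - w‖ + ‖w‖ := by simpa using norm_add_le ((t : ℂ) - w) w
  have im_pos : 0 < |w.im| := abs_pos.2 hw
  have weight_le : 1 + |t| ≤ (1 + (1 + ‖w‖) / |w.im|) * ‖(t : ℂ) - w‖ := by
    have : 1 + ‖w‖ ≤ (1 + ‖w‖) / |w.im| * ‖(t : ℂ) - w‖ := by
      rw [div_mul_eq_mul_div, le_div_iff₀ im_pos]
      gcongr
    linarith
  rw [norm_inv, inv_le_iff_one_le_mul₀ (im_pos.trans_le im_le), mul_right_comm,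
    ← div_eq_mul_inv, le_div_iff₀ (by positivity), one_mul]
  exact weight_le

lemma continuous_inv_ofReal_sub (hw : w.im ≠ 0) : Continuous fun t : ℝ => ((t : ℂ) - w)⁻¹ :=
  (continuous_ofReal.sub continuous_const).inv₀ (ofReal_sub_ne_zero hw)

lemma memLp_inv_ofReal_sub (hw : w.im ≠ 0) : MemLp (fun t : ℝ => ((t : ℂ) - w)⁻¹) 2 volume :=
  memLp_of_norm_le_inv_one_add_abs (continuous_inv_ofReal_sub hw) (norm_inv_ofReal_sub_le hw)

lemma memLp_inv_ofReal_sub_sq (hw : w.im ≠ 0) :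
    MemLp (fun t : ℝ => (((t : ℂ) - w)⁻¹) ^ 2) 2 volume := by
  refine (memLp_inv_ofReal_sub hw).of_le_mul (c := 1 + (1 + ‖w‖) / |w.im|)
    ((continuous_inv_ofReal_sub hw).pow 2).aestronglyMeasurable (ae_of_all _ fun t => ?_)
  rw [norm_pow, sq]
  gcongr
  refine (norm_inv_ofReal_sub_le hw t).trans (mul_le_of_le_one_right (by positivity) ?_)
  exact inv_le_one_of_one_le₀ (by simp)

lemma hasDerivAt_inv_ofReal_sub (hw : w.im ≠ 0) (t : ℝ) :
    HasDerivAt (fun t : ℝ => ((t : ℂ) - w)⁻¹) (-(((t : ℂ) - w)⁻¹) ^ 2) t := by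
  simpa [neg_div, one_div] using
    (((hasDerivAt_id (t : ℂ)).sub_const w).inv (ofReal_sub_ne_zero hw t)).comp_ofReal

/-- Each kernel alone decays too slowly to be weighted square integrable; the difference is
`O(t⁻²)`. -/
lemma isRegular_inv_sub_inv_conj (hw : w.im ≠ 0) :
    IsRegular fun t : ℝ => ((t : ℂ) - w)⁻¹ - ((t : ℂ) - conj w)⁻¹ := by
  have hw' : (conj w).im ≠ 0 := by simpa using hw
  refine .of_memH11 ⟨⟨fun t : ℝ => -(((t : ℂ) - w)⁻¹) ^ 2 - -(((t : ℂ) - conj w)⁻¹) ^ 2,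
    (memLp_inv_ofReal_sub_sq hw).neg.sub (memLp_inv_ofReal_sub_sq hw').neg, fun a b => ?_⟩, ?_⟩
  · have := continuous_inv_ofReal_sub hw
    have := continuous_inv_ofReal_sub hw'
    refine (intervalIntegral.integral_eq_sub_of_hasDerivAt (fun t _ =>
      (hasDerivAt_inv_ofReal_sub hw t).sub (hasDerivAt_inv_ofReal_sub hw' t))
      (Continuous.intervalIntegrable ?_ a b)).symm
    fun_prop
  · refine (((memLp_inv_ofReal_sub hw).const_mul w).sub
      ((memLp_inv_ofReal_sub hw').const_mul (conj w))).ae_eq (ae_of_all _ fun t => ?_)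
    have := ofReal_sub_ne_zero hw t
    have := ofReal_sub_ne_zero hw' t
    simp only [Pi.sub_apply]
    field_simp
    ring

end Pole

section FourierLaplace

variable {a b g φ : ℝ → ℂ} {z : ℂ}

/-- The one-sided Fourier–Laplace transform, which extends a half of the Fourier integral
analytically to the upper half plane. -/
noncomputable def fourierLaplace (a : ℝ → ℂ) (z : ℂ) : ℂ :=
  ∫ s in Ioi (0 : ℝ), a s * exp (2 * Real.pi * I * s * z)

lemma re_two_pi_I_mul (s : ℝ) (z : ℂ) :
    (2 * Real.pi * I * s * z).re = -(2 * Real.pi * s * z.im) := by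
  simp [mul_assoc]

lemma norm_exp_two_pi_I_mul_le_one {s : ℝ} (hs : 0 ≤ s) (hz : 0 ≤ z.im) :
    ‖exp (2 * Real.pi * I * s * z)‖ ≤ 1 := by
  rw [norm_exp, re_two_pi_I_mul, Real.exp_le_one_iff, neg_nonpos]
  positivity

lemma aestronglyMeasurable_mul_exp {μ : Measure ℝ} (ha : AEStronglyMeasurable a μ) (z : ℂ) :
    AEStronglyMeasurable (fun s : ℝ => a s * exp (2 * Real.pi * I * s * z)) μ :=
  ha.mul (by fun_prop : Continuous fun s : ℝ => exp (2 * Real.pi * I * s * z)).aestronglyMeasurable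

lemma norm_mul_exp_le (a : ℝ → ℂ) (hz : 0 ≤ z.im) :
    ∀ᵐ s : ℝ ∂volume.restrict (Ioi 0), ‖a s * exp (2 * Real.pi * I * s * z)‖ ≤ ‖a s‖ := by
  refine (ae_restrict_iff' measurableSet_Ioi).2 (ae_of_all _ fun s hs => ?_)
  rw [norm_mul]
  exact mul_le_of_le_one_right (norm_nonneg _) (norm_exp_two_pi_I_mul_le_one (mem_Ioi.1 hs).le hz)

lemma integrableOn_mul_exp (ha : IntegrableOn a (Ioi 0)) (hz : 0 ≤ z.im) :
    IntegrableOn (fun s : ℝ => a s * exp (2 * Real.pi * I * s * z)) (Ioi 0) :=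
  Integrable.mono ha (aestronglyMeasurable_mul_exp ha.1 z) (norm_mul_exp_le a hz)

lemma norm_fourierLaplace_le (ha : IntegrableOn a (Ioi 0)) (hz : 0 ≤ z.im) :
    ‖fourierLaplace a z‖ ≤ ∫ s in Ioi (0 : ℝ), ‖a s‖ :=
  norm_integral_le_of_norm_le ha.norm (norm_mul_exp_le a hz)

lemma fourierLaplace_sub (ha : IntegrableOn a (Ioi 0)) (hb : IntegrableOn b (Ioi 0))
    (hz : 0 ≤ z.im) : fourierLaplace (a - b) z = fourierLaplace a z - fourierLaplace b z := by
  simp only [fourierLaplace, Pi.sub_apply, sub_mul]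
  exact integral_sub (integrableOn_mul_exp ha hz) (integrableOn_mul_exp hb hz)

lemma continuousOn_fourierLaplace (ha : IntegrableOn a (Ioi 0)) :
    ContinuousOn (fourierLaplace a) {z | 0 ≤ z.im} := by
  refine continuousOn_of_dominated (fun z _ => aestronglyMeasurable_mul_exp ha.1 z)
    (fun z hz => norm_mul_exp_le a hz) ha.norm (ae_of_all _ fun s => Continuous.continuousOn ?_)
  fun_prop

lemma norm_two_pi_I_mul_exp_le {s y : ℝ} (hs : 0 ≤ s) (hy : 0 < y) (hz : y ≤ z.im) :
    ‖2 * Real.pi * I * s * exp (2 * Real.pi * I * s * z)‖ ≤ y⁻¹ := by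
  have norm_factor : ‖(2 * Real.pi * I * s : ℂ)‖ = 2 * Real.pi * s := by
    simp [abs_of_nonneg hs, Real.pi_pos.le]
  rw [norm_mul, norm_factor, norm_exp, re_two_pi_I_mul, Real.exp_neg,
    ← div_eq_mul_inv, div_le_iff₀ (Real.exp_pos _), inv_mul_eq_div, le_div_iff₀ hy]
  calc 2 * Real.pi * s * y ≤ 2 * Real.pi * s * z.im := by gcongr
    _ ≤ Real.exp (2 * Real.pi * s * z.im) := by
      linarith [Real.add_one_le_exp (2 * Real.pi * s * z.im)]

lemma differentiableOn_fourierLaplace (ha : IntegrableOn a (Ioi 0)) :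
    DifferentiableOn ℂ (fourierLaplace a) {z | 0 < z.im} := by
  intro z (hz : 0 < z.im)
  have half_plane_mem_nhds : {w : ℂ | z.im / 2 < w.im} ∈ 𝓝 z :=
    (isOpen_lt continuous_const continuous_im).mem_nhds (half_lt_self hz)
  refine (hasDerivAt_integral_of_dominated_loc_of_deriv_le (μ := volume.restrict (Ioi (0 : ℝ)))
    (F := fun w s => a s * exp (2 * Real.pi * I * s * w))
    (F' := fun w s => a s * (2 * Real.pi * I * s * exp (2 * Real.pi * I * s * w)))
    (bound := fun s => ‖a s‖ * (z.im / 2)⁻¹) half_plane_mem_nhds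
    (Eventually.of_forall fun w => aestronglyMeasurable_mul_exp ha.1 w)
    (integrableOn_mul_exp ha hz.le) (ha.1.mul (Continuous.aestronglyMeasurable (by fun_prop)))
    ?_ (ha.norm.mul_const _) ?_).2.differentiableAt.differentiableWithinAt
  · refine (ae_restrict_iff' measurableSet_Ioi).2 (ae_of_all _ fun s hs w hw => ?_)
    rw [norm_mul]
    gcongr
    exact norm_two_pi_I_mul_exp_le (mem_Ioi.1 hs).le (half_pos hz) (le_of_lt hw)
  · refine ae_of_all _ fun s w _ => ?_
    simpa [mul_comm] using
      (((hasDerivAt_id w).const_mul (2 * Real.pi * I * s : ℂ)).cexp).const_mul (a s)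

lemma two_pi_I_mul_fourierLaplace (hg : ContDiff ℝ 1 g) (hgc : HasCompactSupport g)
    (hz : 0 ≤ z.im) :
    2 * Real.pi * I * z * fourierLaplace g z = -g 0 - fourierLaplace (deriv g) z := by
  have integrable_deriv : IntegrableOn (deriv g) (Ioi 0) :=
    ((hg.continuous_deriv le_rfl).integrable_of_hasCompactSupport hgc.deriv).integrableOn
  have integrable_g : IntegrableOn g (Ioi 0) :=
    (hg.continuous.integrable_of_hasCompactSupport hgc).integrableOn
  have hasDerivAt_exp (s : ℝ) : HasDerivAt (fun s : ℝ => exp (2 * Real.pi * I * s * z))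
      (exp (2 * Real.pi * I * s * z) * (2 * Real.pi * I * z)) s := by
    simpa using
      (((hasDerivAt_id (s : ℂ)).const_mul (2 * Real.pi * I : ℂ)).mul_const z).cexp.comp_ofReal
  have hasDerivAt_mul (s : ℝ) : HasDerivAt (fun s : ℝ => g s * exp (2 * Real.pi * I * s * z))
      (deriv g s * exp (2 * Real.pi * I * s * z)
        + 2 * Real.pi * I * z * (g s * exp (2 * Real.pi * I * s * z))) s :=
    ((hg.differentiable one_ne_zero s).hasDerivAt.mul (hasDerivAt_exp s)).congr_deriv (by ring)
  have tendsto_zero : Tendsto (fun s : ℝ => g s * exp (2 * Real.pi * I * s * z)) atTop (𝓝 0) :=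
    HasCompactSupport.is_zero_at_infty hgc.mul_right |>.mono_left atTop_le_cocompact
  have by_parts := integral_Ioi_of_hasDerivAt_of_tendsto' (fun s _ => hasDerivAt_mul s)
    ((integrableOn_mul_exp integrable_deriv hz).add
      ((integrableOn_mul_exp integrable_g hz).const_mul (2 * Real.pi * I * z))) tendsto_zero
  rw [integral_add (integrableOn_mul_exp integrable_deriv hz)
    ((integrableOn_mul_exp integrable_g hz).const_mul _), integral_const_mul] at by_parts
  rw [fourierLaplace, fourierLaplace, eq_sub_iff_add_eq', by_parts]
  simp

lemma tendsto_fourierLaplace_of_contDiff (hg : ContDiff ℝ 1 g) (hgc : HasCompactSupport g) :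
    Tendsto (fourierLaplace g) (cobounded ℂ ⊓ 𝓟 {z | 0 ≤ z.im}) (𝓝 0) := by
  refine (IsBigO.of_bound ((2 * Real.pi)⁻¹ * (‖g 0‖ + ∫ s in Ioi (0 : ℝ), ‖deriv g s‖))
    ?_).trans_tendsto (tendsto_inv₀_cobounded.mono_left inf_le_left)
  filter_upwards [mem_inf_of_left (eventually_ne_cobounded 0),
    mem_inf_of_right (mem_principal_self _)] with z hz0 hz
  rw [norm_inv, ← div_eq_mul_inv, le_div_iff₀ (norm_pos_iff.2 hz0), ← div_eq_inv_mul,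
    le_div_iff₀ (by positivity)]
  calc ‖fourierLaplace g z‖ * ‖z‖ * (2 * Real.pi)
      = ‖2 * Real.pi * I * z * fourierLaplace g z‖ := by
        simp [abs_of_pos Real.pi_pos]
        ring
    _ ≤ ‖g 0‖ + ‖fourierLaplace (deriv g) z‖ := by
      rw [two_pi_I_mul_fourierLaplace hg hgc hz, ← norm_neg (g 0)]
      exact norm_sub_le _ _
    _ ≤ _ := by
      gcongr
      exact norm_fourierLaplace_le ((hg.continuous_deriv le_rfl).integrable_of_hasCompactSupport
        hgc.deriv).integrableOn hz

lemma tendsto_fourierLaplace (ha : IntegrableOn a (Ioi 0)) :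
    Tendsto (fourierLaplace a) (cobounded ℂ ⊓ 𝓟 {z | 0 ≤ z.im}) (𝓝 0) := by
  refine Metric.tendsto_nhds.2 fun ε hε => ?_
  obtain ⟨g, hgc, hg, hga⟩ := (memLp_one_iff_integrable.2 ha).exist_eLpNorm_sub_le
    (by norm_num) le_rfl (half_pos hε)
  have integrable_g : IntegrableOn g (Ioi 0) :=
    (hg.continuous.integrable_of_hasCompactSupport hgc).integrableOn
  have integral_sub_le : ∫ s in Ioi (0 : ℝ), ‖(a - g) s‖ ≤ ε / 2 := by
    rw [integral_norm_eq_lintegral_enorm (ha.sub integrable_g).1, ← eLpNorm_one_eq_lintegral_enorm]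
    exact ENNReal.toReal_le_of_le_ofReal (half_pos hε).le hga
  have small_g := Metric.tendsto_nhds.1 (tendsto_fourierLaplace_of_contDiff
    (hg.of_le (by exact_mod_cast le_top)) hgc) (ε / 2) (half_pos hε)
  filter_upwards [small_g, mem_inf_of_right (mem_principal_self _)] with z hgz hz
  rw [dist_zero_right] at hgz ⊢
  calc ‖fourierLaplace a z‖ = ‖fourierLaplace (a - g) z + fourierLaplace g z‖ := by
        rw [fourierLaplace_sub ha integrable_g hz, sub_add_cancel]
    _ ≤ ‖fourierLaplace (a - g) z‖ + ‖fourierLaplace g z‖ := norm_add_le _ _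
    _ < ε / 2 + ε / 2 := add_lt_add_of_le_of_lt
        ((norm_fourierLaplace_le (ha.sub integrable_g) hz).trans integral_sub_le) hgz
    _ = ε := add_halves ε

end FourierLaplace

section CauchyIntegral

variable {φ : ℝ → ℂ} {z : ℂ}

lemma re_two_pi_I_mul_neg (hz : 0 < z.im) : (2 * Real.pi * I * z).re < 0 := by
  simpa using mul_pos Real.two_pi_pos hz

lemma integrableOn_exp_two_pi_I_mul (hz : 0 < z.im) :
    IntegrableOn (fun s : ℝ => exp (2 * Real.pi * I * s * z)) (Ioi 0) := by
  simpa only [mul_right_comm _ z] using integrableOn_exp_mul_complex_Ioi (re_two_pi_I_mul_neg hz) 0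

lemma integral_exp_two_pi_I_mul (hz : 0 < z.im) :
    ∫ s in Ioi (0 : ℝ), exp (2 * Real.pi * I * s * z) = -(2 * Real.pi * I * z)⁻¹ := by
  simpa [neg_div, mul_right_comm _ z] using integral_exp_mul_complex_Ioi (re_two_pi_I_mul_neg hz) 0

lemma fourierLaplace_fourier (hφ : Integrable φ) (hz : 0 < z.im) :
    fourierLaplace (𝓕 φ) z = ∫ t, φ t * -(2 * Real.pi * I * (z - t))⁻¹ := by
  have integrable_prod : Integrable
      (fun p : ℝ × ℝ => φ p.2 * exp (2 * Real.pi * I * p.1 * (z - p.2)))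
      ((volume.restrict (Ioi 0)).prod volume) := by
    refine ((integrableOn_exp_two_pi_I_mul hz).mul_prod hφ).congr' (hφ.1.comp_snd.mul
      (Continuous.aestronglyMeasurable (by fun_prop))) (ae_of_all _ fun p => ?_)
    simp only [norm_mul, norm_exp, re_two_pi_I_mul, sub_im, ofReal_im, sub_zero, mul_comm ‖φ p.2‖]
  calc fourierLaplace (𝓕 φ) z
      = ∫ s in Ioi (0 : ℝ), ∫ t, φ t * exp (2 * Real.pi * I * s * (z - t)) := by
        refine integral_congr_ae (ae_of_all _ fun s => ?_)
        simp only [Real.fourier_real_eq_integral_exp_smul, ← integral_mul_const]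
        congr with t
        rw [smul_eq_mul, mul_comm (exp _), mul_assoc, ← exp_add]
        push_cast
        ring_nf
    _ = ∫ t, ∫ s in Ioi (0 : ℝ), φ t * exp (2 * Real.pi * I * s * (z - t)) :=
        integral_integral_swap integrable_prod
    _ = _ := by
        congr with t
        rw [integral_const_mul, integral_exp_two_pi_I_mul (by simpa using hz)]

lemma integral_norm_inv_sub_ofReal_sq (hz : 0 < z.im) :
    ∫ t : ℝ, ‖(z - t)⁻¹‖ ^ 2 = Real.pi / z.im := by
  have rescale (t : ℝ) :
      ‖(z - t)⁻¹‖ ^ 2 = (z.im ^ 2)⁻¹ * (1 + ((t - z.re) / z.im) ^ 2)⁻¹ := by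
    rw [norm_inv, inv_pow, ← normSq_eq_norm_sq, normSq_apply, ← mul_inv]
    simp only [sub_re, ofReal_re, sub_im, ofReal_im, sub_zero]
    congr 1
    field_simp
    ring
  simp only [rescale]
  rw [integral_const_mul, integral_sub_right_eq_self (fun t => (1 + (t / z.im) ^ 2)⁻¹),
    Measure.integral_comp_div (fun t => (1 + t ^ 2)⁻¹), integral_univ_inv_one_add_sq,
    abs_of_pos hz, smul_eq_mul]
  field_simp

lemma norm_inv_sub_mul_mul_norm_le (z t c : ℂ) :
    ‖(z - t)⁻¹ * c‖ * ‖z‖ ≤ ‖c‖ + (‖t * c‖ ^ 2 + ‖(z - t)⁻¹‖ ^ 2) := by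
  rcases eq_or_ne (z - t) 0 with sub_eq_zero | sub_ne_zero
  · simp only [sub_eq_zero, inv_zero, zero_mul, norm_zero]
    positivity
  calc ‖(z - t)⁻¹ * c‖ * ‖z‖ ≤ ‖(z - t)⁻¹ * c‖ * (‖z - t‖ + ‖t‖) := by
        gcongr
        simpa using norm_add_le (z - t) t
    _ = ‖c‖ + ‖t * c‖ * ‖(z - t)⁻¹‖ := by
        have := norm_ne_zero_iff.2 sub_ne_zero
        rw [norm_mul, norm_mul, norm_inv]
        field_simp
    _ ≤ _ := by
        gcongr
        nlinarith [sq_nonneg (‖t * c‖ - ‖(z - t)⁻¹‖), sq_nonneg (‖t * c‖ + ‖(z - t)⁻¹‖)]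

lemma norm_fourierLaplace_fourier_mul_norm_le (hφ : IsWeightedL2 φ) (hz : 0 < z.im) :
    ‖fourierLaplace (𝓕 φ) z‖ * ‖z‖ ≤
      (∫ t, ‖φ t‖) + ((∫ t : ℝ, ‖(t : ℂ) * φ t‖ ^ 2) + Real.pi / z.im) := by
  have memLp_mul : MemLp (fun t : ℝ => (t : ℂ) * φ t) 2 volume := by
    have continuous := hφ.continuous
    refine hφ.memLp_smul.mono (Continuous.aestronglyMeasurable (by fun_prop))
      (ae_of_all _ fun t => ?_)
    rw [norm_mul, norm_smul, norm_real, Real.norm_eq_abs, Real.norm_eq_abs]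
    exact mul_le_mul_of_nonneg_right ((lt_one_add |t|).le.trans (le_abs_self _))
      (norm_nonneg _)
  have integrable_sq : Integrable fun t : ℝ => ‖(t : ℂ) * φ t‖ ^ 2 :=
    memLp_mul.integrable_norm_pow two_ne_zero
  have integrable_kernel_sq : Integrable fun t : ℝ => ‖(z - t)⁻¹‖ ^ 2 := by
    simpa only [norm_inv, norm_sub_rev z] using
      (memLp_inv_ofReal_sub hz.ne').integrable_norm_pow two_ne_zero
  have integrable_sum : Integrable fun t : ℝ => ‖(t : ℂ) * φ t‖ ^ 2 + ‖(z - t)⁻¹‖ ^ 2 :=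
    integrable_sq.add integrable_kernel_sq
  rw [fourierLaplace_fourier hφ.integrable hz, ← norm_mul, ← integral_mul_const,
    ← integral_norm_inv_sub_ofReal_sq hz, ← integral_add integrable_sq integrable_kernel_sq,
    ← integral_add hφ.integrable.norm integrable_sum]
  refine norm_integral_le_of_norm_le (hφ.integrable.norm.add integrable_sum)
    (ae_of_all _ fun t => ?_)
  refine le_trans ?_ (norm_inv_sub_mul_mul_norm_le z t (φ t))
  rw [norm_mul]
  gcongr
  have one_le_two_pi : 1 ≤ ‖(2 * Real.pi * I : ℂ)‖ := by
    simpa [abs_of_pos Real.pi_pos] using (by linarith [Real.two_le_pi] : 1 ≤ 2 * Real.pi)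
  rw [mul_inv, mul_comm (φ t), ← neg_mul, mul_assoc, norm_mul, norm_neg, norm_inv]
  exact mul_le_of_le_one_left (norm_nonneg _) (inv_le_one_of_one_le₀ one_le_two_pi)

lemma isBigO_fourierLaplace_fourier (hφ : IsWeightedL2 φ) {δ : ℝ} (hδ : 0 < δ) :
    fourierLaplace (𝓕 φ) =O[cobounded ℂ ⊓ 𝓟 {w | δ ≤ w.im}] fun w => w⁻¹ := by
  refine .of_bound ((∫ t, ‖φ t‖) + ((∫ t : ℝ, ‖(t : ℂ) * φ t‖ ^ 2) + Real.pi / δ)) ?_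
  filter_upwards [mem_inf_of_left (eventually_ne_cobounded 0),
    mem_inf_of_right (mem_principal_self _)] with z hz0 (hz : δ ≤ z.im)
  rw [norm_inv, ← div_eq_mul_inv, le_div_iff₀ (norm_pos_iff.2 hz0)]
  refine (norm_fourierLaplace_fourier_mul_norm_le hφ (hδ.trans_le hz)).trans ?_
  gcongr

lemma fourierLaplace_fourier_add_neg (hφ : Integrable φ) (hc : Continuous φ)
    (hF : Integrable (𝓕 φ)) (t : ℝ) :
    fourierLaplace (𝓕 φ) t + fourierLaplace (fun s => 𝓕 φ (-s)) (-t) = φ t := by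
  have integrable_integrand :
      Integrable fun s : ℝ => 𝓕 φ s * exp (2 * Real.pi * I * s * t) :=
    hF.mono (aestronglyMeasurable_mul_exp hF.1 t) (ae_of_all _ fun s => by
      simp [norm_exp, mul_assoc])
  have inversion : ∫ s : ℝ, 𝓕 φ s * exp (2 * Real.pi * I * s * t) = φ t := by
    rw [← congrFun (hc.fourierInv_fourier_eq hφ hF) t, Real.fourierInv_eq']
    congr with s
    rw [smul_eq_mul, mul_comm]
    congr 2
    simp only [Real.inner_apply, ofReal_mul, ofReal_ofNat]
    ring
  have reflect := integral_comp_neg_Ioi 0 fun s : ℝ => 𝓕 φ s * exp (2 * Real.pi * I * s * t)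
  rw [neg_zero] at reflect
  rw [← inversion, ← intervalIntegral.integral_Iic_add_Ioi integrable_integrand.integrableOn
    integrable_integrand.integrableOn (b := 0), add_comm, ← reflect]
  simp [fourierLaplace]

end CauchyIntegral

section Decay

variable {φ : ℝ → ℂ} {f : ℂ → ℂ}

/-- Functions analytic in the upper half plane and continuous up to the boundary, with the decay
required of the entries of `M - I`. -/
structure IsDecaying (f : ℂ → ℂ) : Prop where
  continuousOn : ContinuousOn f {z | 0 ≤ z.im}
  differentiableOn : DifferentiableOn ℂ f {z | 0 < z.im}
  tendsto_zero : Tendsto f (cobounded ℂ ⊓ 𝓟 {z | 0 ≤ z.im}) (𝓝 0)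
  isBigO : ∀ δ : ℝ, 0 < δ → f =O[cobounded ℂ ⊓ 𝓟 {w | δ ≤ w.im}] fun w => w⁻¹

lemma IsDecaying.neg (hf : IsDecaying f) : IsDecaying (-f) :=
  ⟨hf.continuousOn.neg, hf.differentiableOn.neg,
    by simpa only [neg_zero] using! hf.tendsto_zero.neg, fun δ hδ => (hf.isBigO δ hδ).neg_left⟩

lemma isDecaying_fourierLaplace_fourier (hφ : IsWeightedL2 φ) (hF : Integrable (𝓕 φ)) :
    IsDecaying (fourierLaplace (𝓕 φ)) :=
  ⟨continuousOn_fourierLaplace hF.integrableOn, differentiableOn_fourierLaplace hF.integrableOn,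
    tendsto_fourierLaplace hF.integrableOn, fun _ => isBigO_fourierLaplace_fourier hφ⟩

lemma isDecaying_fourierLaplace_fourier_neg (hφ : IsWeightedL2 φ) (hF : Integrable (𝓕 φ)) :
    IsDecaying (fourierLaplace fun s => 𝓕 φ (-s)) := by
  rw [← fourier_comp_neg]
  exact isDecaying_fourierLaplace_fourier hφ.comp_neg (fourier_comp_neg φ ▸ hF.comp_neg)

end Decay

/-- Lebesgue measure on the half line `(0, ∞)`. -/
noncomputable abbrev halfLine : Measure ℝ := volume.restrict (Ioi 0)

section Hardy

variable {f v : ℝ → ℂ} {a b : ℝ → ℝ}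

lemma aestronglyMeasurable_indicator_mul (ha : AEStronglyMeasurable a halfLine)
    (hb : AEStronglyMeasurable b halfLine) :
    AEStronglyMeasurable ({p : ℝ × ℝ | p.2 < p.1}.indicator fun p => a p.1 * b p.2)
      (halfLine.prod halfLine) :=
  (ha.comp_fst.mul hb.comp_snd).indicator (measurableSet_lt measurable_snd measurable_fst)

lemma integrable_mul_rpow (ha : AEStronglyMeasurable a halfLine)
    (ha' : Integrable (fun r => r ^ (1 / 2 : ℝ) * a r) halfLine) :
    Integrable ({p : ℝ × ℝ | p.2 < p.1}.indicator fun p => a p.1 * p.2 ^ (-(1 / 2) : ℝ))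
      (halfLine.prod halfLine) := by
  have rpow_measurable : Measurable fun t : ℝ => t ^ (-(1 / 2) : ℝ) := by fun_prop
  have restrict_slice (r : ℝ) : halfLine.restrict (Iio r) = volume.restrict (Ioo 0 r) := by
    rw [Measure.restrict_restrict measurableSet_Iio, inter_comm, Ioi_inter_Iio]
  refine (integrable_prod_iff (aestronglyMeasurable_indicator_mul ha
    rpow_measurable.aestronglyMeasurable)).2 ⟨?_, (ha'.norm.const_mul 2).congr ?_⟩ <;>
  refine (ae_restrict_mem measurableSet_Ioi).mono fun r (hr : 0 < r) => ?_
  · change Integrable ((Iio r).indicator fun t => a r * t ^ (-(1 / 2) : ℝ)) halfLine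
    rw [integrable_indicator_iff measurableSet_Iio, IntegrableOn, restrict_slice]
    exact ((intervalIntegrable_iff_integrableOn_Ioo_of_le hr.le).1
      (intervalIntegral.intervalIntegrable_rpow' (by norm_num))).const_mul _
  · change _ = ∫ t, ‖(Iio r).indicator (fun t => a r * t ^ (-(1 / 2) : ℝ)) t‖ ∂halfLine
    have integral_slice : ∫ t in Ioo 0 r, ‖t ^ (-(1 / 2) : ℝ)‖ = 2 * r ^ (1 / 2 : ℝ) := by
      rw [setIntegral_congr_fun measurableSet_Ioo fun t ht =>
        Real.norm_of_nonneg (Real.rpow_nonneg ht.1.le _), ← integral_Ioc_eq_integral_Ioo,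
        ← intervalIntegral.integral_of_le hr.le, integral_rpow (by norm_num)]
      norm_num
      ring
    simp only [norm_indicator_eq_indicator_norm]
    rw [integral_indicator measurableSet_Iio, restrict_slice]
    simp only [norm_mul (a r), integral_const_mul, integral_slice, norm_mul,
      Real.norm_of_nonneg (Real.rpow_nonneg hr.le _)]
    ring

lemma integrable_rpow_mul (hb : Integrable b halfLine) :
    Integrable ({p : ℝ × ℝ | p.2 < p.1}.indicator
        fun p => p.1 ^ (-(3 / 2) : ℝ) * (p.2 ^ (1 / 2 : ℝ) * b p.2))
      (halfLine.prod halfLine) := by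
  have rpow_measurable : Measurable fun t : ℝ => t ^ (-(3 / 2) : ℝ) := by fun_prop
  have sqrt_measurable : Measurable fun t : ℝ => t ^ (1 / 2 : ℝ) := by fun_prop
  have restrict_slice {t : ℝ} (ht : 0 < t) :
      halfLine.restrict (Ioi t) = volume.restrict (Ioi t) := by
    rw [Measure.restrict_restrict measurableSet_Ioi, Ioi_inter_Ioi, max_eq_left ht.le]
  refine (integrable_prod_iff' (aestronglyMeasurable_indicator_mul
    rpow_measurable.aestronglyMeasurable (sqrt_measurable.aestronglyMeasurable.mul hb.1))).2
    ⟨?_, (hb.norm.const_mul 2).congr ?_⟩ <;>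
  refine (ae_restrict_mem measurableSet_Ioi).mono fun t (ht : 0 < t) => ?_
  · change Integrable
      ((Ioi t).indicator fun r => r ^ (-(3 / 2) : ℝ) * (t ^ (1 / 2 : ℝ) * b t)) halfLine
    rw [integrable_indicator_iff measurableSet_Ioi, IntegrableOn, restrict_slice ht]
    exact (integrableOn_Ioi_rpow_of_lt (by norm_num) ht).mul_const _
  · change _ = ∫ r, ‖(Ioi t).indicator
      (fun r => r ^ (-(3 / 2) : ℝ) * (t ^ (1 / 2 : ℝ) * b t)) r‖ ∂halfLine
    have integral_slice : ∫ r in Ioi t, ‖r ^ (-(3 / 2) : ℝ)‖ = 2 * (t ^ (1 / 2 : ℝ))⁻¹ := by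
      rw [setIntegral_congr_fun measurableSet_Ioi fun r hr =>
        Real.norm_of_nonneg (Real.rpow_nonneg (ht.trans hr).le _),
        integral_Ioi_rpow_of_lt (by norm_num) ht, ← Real.rpow_neg ht.le]
      norm_num
      ring
    simp only [norm_indicator_eq_indicator_norm]
    rw [integral_indicator measurableSet_Ioi, restrict_slice ht]
    simp only [norm_mul, integral_mul_const, integral_slice,
      Real.norm_of_nonneg (Real.rpow_nonneg ht.le _)]
    have : t ^ (1 / 2 : ℝ) ≠ 0 := (Real.rpow_pos_of_pos ht _).ne'
    field_simp

lemma mul_le_rpow_mul_sq_add {r t : ℝ} (hr : 0 < r) (ht : 0 < t) (x y : ℝ) :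
    x * y ≤ r ^ (3 / 2 : ℝ) * x ^ 2 * t ^ (-(1 / 2) : ℝ) +
      r ^ (-(3 / 2) : ℝ) * (t ^ (1 / 2 : ℝ) * y ^ 2) := by
  have weight_pos : 0 < r ^ (3 / 2 : ℝ) * t ^ (-(1 / 2) : ℝ) := by positivity
  have inv_weight :
      r ^ (-(3 / 2) : ℝ) * t ^ (1 / 2 : ℝ) = (r ^ (3 / 2 : ℝ) * t ^ (-(1 / 2) : ℝ))⁻¹ := by
    rw [mul_inv, ← Real.rpow_neg hr.le, ← Real.rpow_neg ht.le, neg_neg]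
  rw [← mul_assoc, inv_weight, mul_right_comm]
  generalize r ^ (3 / 2 : ℝ) * t ^ (-(1 / 2) : ℝ) = w at *
  have : w * x ^ 2 + w⁻¹ * y ^ 2 - x * y = w⁻¹ * ((w * x - y / 2) ^ 2 + 3 / 4 * y ^ 2) := by
    field_simp
    ring
  rw [← sub_nonneg, this]
  positivity

/-- Hardy's inequality in bilinear form: the weight `r ^ (3/2) * t ^ (-1/2)` in Young's inequality
makes both terms integrable over `t < r`. -/
lemma integrable_indicator_mul_of_memLp (hf : AEStronglyMeasurable f halfLine)
    (hf' : MemLp (fun r : ℝ => r • f r) 2 halfLine) (hv : MemLp v 2 halfLine) :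
    Integrable ({p : ℝ × ℝ | p.2 < p.1}.indicator fun p => f p.1 * v p.2)
      (halfLine.prod halfLine) := by
  have rpow_measurable : Measurable fun r : ℝ => r ^ (3 / 2 : ℝ) := by fun_prop
  have weight_integrable :
      Integrable (fun r : ℝ => r ^ (1 / 2 : ℝ) * (r ^ (3 / 2 : ℝ) * ‖f r‖ ^ 2)) halfLine := by
    refine (hf'.integrable_norm_pow two_ne_zero).congr
      ((ae_restrict_mem measurableSet_Ioi).mono fun r (hr : 0 < r) => ?_)
    simp only [norm_smul, mul_pow, Real.norm_of_nonneg hr.le]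
    rw [← mul_assoc, ← Real.rpow_add hr]
    norm_num
  refine ((integrable_mul_rpow (rpow_measurable.aestronglyMeasurable.mul (hf.norm.pow 2))
    weight_integrable).add (integrable_rpow_mul (hv.integrable_norm_pow two_ne_zero))).mono'
    ((hf.comp_fst.mul hv.1.comp_snd).indicator (measurableSet_lt measurable_snd measurable_fst)) ?_
  rw [Measure.prod_restrict]
  refine (ae_restrict_mem (measurableSet_Ioi.prod measurableSet_Ioi)).mono fun p hp => ?_
  rw [norm_indicator_eq_indicator_norm, ← indicator_add']
  refine indicator_le_indicator ?_
  rw [norm_mul]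
  exact mul_le_rpow_mul_sq_add hp.1 hp.2 _ _

/-- The Hankel operator `H_f v(s) = ∫₀^∞ f(s + t) v(t) dt`. -/
noncomputable def hankel (f v : ℝ → ℂ) (s : ℝ) : ℂ := ∫ t in Ioi 0, f (s + t) * v t

lemma integrable_hankel_of_memLp (hf : AEStronglyMeasurable f halfLine)
    (hf' : MemLp (fun r : ℝ => r • f r) 2 halfLine) (hv : MemLp v 2 halfLine) :
    Integrable (hankel f v) halfLine := by
  have indicator_integrable := integrable_indicator_mul_of_memLp hf hf' hv
  rw [integrable_indicator_iff (measurableSet_lt measurable_snd measurable_fst), IntegrableOn,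
    Measure.prod_restrict, Measure.restrict_restrict
      (measurableSet_lt measurable_snd measurable_fst)] at indicator_integrable
  have sheared := ((measurePreserving_add_prod volume volume).restrict_preimage
    ((measurableSet_lt measurable_snd measurable_fst).inter
      (measurableSet_Ioi.prod measurableSet_Ioi))).integrable_comp_of_integrable
    indicator_integrable
  have preimage_eq : (fun p : ℝ × ℝ => (p.1 + p.2, p.2)) ⁻¹'
      ({p | p.2 < p.1} ∩ Ioi 0 ×ˢ Ioi 0) = Ioi 0 ×ˢ Ioi 0 := by
    ext ⟨s, t⟩
    exact ⟨fun ⟨(h : t < s + t), _, ht⟩ => ⟨pos_of_lt_add_left h, ht⟩,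
      fun ⟨hs, ht⟩ => ⟨lt_add_of_pos_left t hs, add_pos (mem_Ioi.1 hs) ht, ht⟩⟩
  rw [preimage_eq, ← Measure.prod_restrict] at sheared
  exact sheared.integral_prod_left

end Hardy

section L1L2

variable {f v : ℝ → ℂ}

lemma integrable_shift_mul {R : Type*} [NormedRing R] {f v : ℝ → R} (hf : Integrable f)
    (hv : Integrable v halfLine) :
    Integrable (fun p : ℝ × ℝ => f (p.1 + p.2) * v p.2) (volume.prod halfLine) :=
  (measurePreserving_add_prod volume halfLine).integrable_comp_of_integrable (hf.mul_prod hv)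

lemma integrable_hankel (hf : Integrable f) (hv : Integrable v halfLine) :
    Integrable (hankel f v) :=
  (integrable_shift_mul hf hv).integral_prod_left

lemma integrable_shift_mul_slice (hf : MemLp f 2 volume) (hv : MemLp v 2 halfLine) (s : ℝ) :
    Integrable (fun t => f (s + t) * v t) halfLine :=
  ((hf.comp_measurePreserving (measurePreserving_add_left volume s)).restrict _).integrable_mul hv

lemma sq_lintegral_mul_le {α : Type*} [MeasurableSpace α] {μ : Measure α} {k w : α → ENNReal}
    (hk : AEMeasurable k μ) (hw : AEMeasurable w μ) :
    (∫⁻ a, k a * w a ∂μ) ^ 2 ≤ (∫⁻ a, k a ∂μ) * ∫⁻ a, k a * w a ^ 2 ∂μ := by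
  have cauchy_schwarz := ENNReal.lintegral_mul_le_Lp_mul_Lq μ Real.HolderConjugate.two_two
    (hk.pow_const (1 / 2 : ℝ)) ((hk.pow_const (1 / 2 : ℝ)).mul hw)
  have sq_rpow_half (x : ENNReal) : (x ^ (1 / 2 : ℝ)) ^ (2 : ℕ) = x := by
    rw [← ENNReal.rpow_mul_natCast]
    norm_num
  simp only [Pi.mul_apply, ENNReal.rpow_ofNat, mul_pow, ← mul_assoc, ← sq, sq_rpow_half]
    at cauchy_schwarz
  simpa only [mul_pow, sq_rpow_half] using pow_le_pow_left' cauchy_schwarz 2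

lemma eLpNorm_hankel_le (hf : Integrable f) (hv : AEStronglyMeasurable v halfLine) :
    eLpNorm (hankel f v) 2 halfLine ≤ eLpNorm f 1 volume * eLpNorm v 2 halfLine := by
  have shift_le (s : ℝ) : ∫⁻ t in Ioi 0, ‖f (s + t)‖ₑ ≤ eLpNorm f 1 volume := by
    rw [eLpNorm_one_eq_lintegral_enorm, ← lintegral_add_left_eq_self (fun t => ‖f t‖ₑ) s]
    exact setLIntegral_le_lintegral _ _
  have pointwise (s : ℝ) : ‖hankel f v s‖ₑ ^ 2 ≤
      eLpNorm f 1 volume * ∫⁻ t in Ioi 0, ‖f (s + t)‖ₑ * ‖v t‖ₑ ^ 2 := by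
    refine (pow_le_pow_left' (enorm_integral_le_lintegral_enorm _) 2).trans ?_
    simp only [enorm_mul]
    refine (sq_lintegral_mul_le ?_ hv.enorm).trans (mul_le_mul_left (shift_le s) _)
    exact (hf.1.comp_measurePreserving (measurePreserving_add_left volume s)).restrict.enorm
  have measurable : AEMeasurable (fun p : ℝ × ℝ => ‖f (p.1 + p.2)‖ₑ * ‖v p.2‖ₑ ^ 2)
      (halfLine.prod halfLine) := by
    refine (AEMeasurable.comp_quasiMeasurePreserving
      (hf.1.enorm.comp_fst.mul (hv.enorm.pow_const 2).comp_snd)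
      (measurePreserving_add_prod volume halfLine).quasiMeasurePreserving).mono_measure ?_
    exact Measure.prod_mono Measure.restrict_le_self le_rfl
  have norm_ne_top : eLpNorm f 1 volume ≠ ⊤ := (memLp_one_iff_integrable.2 hf).eLpNorm_ne_top
  refine (ENNReal.pow_le_pow_left_iff two_ne_zero).1 ?_
  rw [mul_pow, eLpNorm_two_sq, eLpNorm_two_sq]
  calc ∫⁻ s in Ioi 0, ‖hankel f v s‖ₑ ^ 2
      ≤ ∫⁻ s in Ioi 0, eLpNorm f 1 volume * ∫⁻ t in Ioi 0, ‖f (s + t)‖ₑ * ‖v t‖ₑ ^ 2 :=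
        lintegral_mono pointwise
    _ = eLpNorm f 1 volume * ∫⁻ t in Ioi 0, (∫⁻ s in Ioi 0, ‖f (t + s)‖ₑ) * ‖v t‖ₑ ^ 2 := by
        rw [lintegral_const_mul' _ _ norm_ne_top,
          lintegral_lintegral_swap measurable]
        congr! 3 with t
        rw [lintegral_mul_const' _ _ (by finiteness)]
        simp only [add_comm]
    _ ≤ eLpNorm f 1 volume * ∫⁻ t in Ioi 0, eLpNorm f 1 volume * ‖v t‖ₑ ^ 2 := by
        gcongr with t
        exact shift_le t
    _ = eLpNorm f 1 volume ^ 2 * ∫⁻ t in Ioi 0, ‖v t‖ₑ ^ 2 := by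
        rw [lintegral_const_mul' _ _ norm_ne_top, sq, mul_assoc]

end L1L2

section HankelOperator

variable {f v w : ℝ → ℂ}

lemma IsWeightedL2.conj (hf : IsWeightedL2 f) : IsWeightedL2 fun s => conj (f s) :=
  hf.of_norm_le (continuous_conj.comp hf.continuous) 1 fun t => by rw [RCLike.norm_conj, one_mul]

lemma hankel_congr (f : ℝ → ℂ) (h : v =ᵐ[halfLine] w) : hankel f v = hankel f w := by
  funext s
  exact integral_congr_ae (h.mono fun t ht => congrArg (f (s + t) * ·) ht)

lemma IsWeightedL2.aestronglyMeasurable_shift_mul (hf : IsWeightedL2 f)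
    (hv : AEStronglyMeasurable v halfLine) :
    AEStronglyMeasurable (fun p : ℝ × ℝ => f (p.1 + p.2) * v p.2) (halfLine.prod halfLine) :=
  (hf.continuous.comp continuous_add).aestronglyMeasurable.mul hv.comp_snd

lemma IsWeightedL2.memLp_hankel (hf : IsWeightedL2 f) (hv : MemLp v 2 halfLine) :
    MemLp (hankel f v) 2 halfLine :=
  ⟨(hf.aestronglyMeasurable_shift_mul hv.1).integral_prod_right',
    (eLpNorm_hankel_le hf.integrable hv.1).trans_lt <|
      ENNReal.mul_lt_top (memLp_one_iff_integrable.2 hf.integrable).2 hv.2⟩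

lemma IsWeightedL2.integrable_const_mul_add_hankel (hf : IsWeightedL2 f) (c : ℂ)
    (hv : MemLp v 2 halfLine) : Integrable (fun s => c * f s + hankel f v s) halfLine := by
  refine (hf.integrable.restrict.const_mul c).add
    (integrable_hankel_of_memLp hf.continuous.aestronglyMeasurable ?_ hv)
  have measurable : Continuous fun r : ℝ => r • f r := continuous_id.smul hf.continuous
  refine (hf.memLp_smul.mono measurable.aestronglyMeasurable (ae_of_all _ fun r => ?_)).restrict _
  rw [norm_smul, norm_smul, Real.norm_eq_abs, Real.norm_of_nonneg (by positivity)]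
  gcongr
  linarith

/-- The Hankel operator with symbol `f`, as a bounded operator on `L²(0, ∞)`. -/
noncomputable def hankelCLM (hf : IsWeightedL2 f) : Lp ℂ 2 halfLine →L[ℂ] Lp ℂ 2 halfLine :=
  LinearMap.mkContinuous
    { toFun v := (hf.memLp_hankel (Lp.memLp v)).toLp
      map_add' v w := by
        rw [← MemLp.toLp_add]
        refine MemLp.toLp_congr _ _ (ae_of_all _ fun s => ?_)
        rw [hankel_congr f (Lp.coeFn_add v w), Pi.add_apply, hankel, hankel, hankel,
          ← integral_add (integrable_shift_mul_slice hf.memLp (Lp.memLp v) s)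
            (integrable_shift_mul_slice hf.memLp (Lp.memLp w) s)]
        simp only [Pi.add_apply, mul_add]
      map_smul' c v := by
        rw [RingHom.id_apply, ← MemLp.toLp_const_smul]
        refine MemLp.toLp_congr _ _ (ae_of_all _ fun s => ?_)
        rw [hankel_congr f (Lp.coeFn_smul c v), Pi.smul_apply, hankel, hankel, smul_eq_mul,
          ← integral_const_mul]
        simp only [Pi.smul_apply, smul_eq_mul, mul_left_comm] }
    (eLpNorm f 1 volume).toReal fun v => by
      have norm_ne_top := (memLp_one_iff_integrable.2 hf.integrable).eLpNorm_ne_top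
      simp only [LinearMap.coe_mk, AddHom.coe_mk, Lp.norm_toLp]
      rw [Lp.norm_def, ← ENNReal.toReal_mul]
      exact ENNReal.toReal_mono (ENNReal.mul_ne_top norm_ne_top (Lp.eLpNorm_ne_top v))
        (eLpNorm_hankel_le hf.integrable (Lp.memLp v).1)

lemma hankelCLM_coeFn (hf : IsWeightedL2 f) (v : Lp ℂ 2 halfLine) :
    hankelCLM hf v =ᵐ[halfLine] hankel f v :=
  (hf.memLp_hankel (Lp.memLp v)).coeFn_toLp

lemma integrable_mul_shift_mul_conj (hf : IsWeightedL2 f) {u v : ℝ → ℂ}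
    (hu : MemLp u 2 halfLine) (hv : MemLp v 2 halfLine) :
    Integrable (fun p : ℝ × ℝ => u p.1 * (f (p.1 + p.2) * conj (v p.2)))
      (halfLine.prod halfLine) := by
  have shift_integrable {w : ℝ → ℂ} (hw : MemLp w 2 halfLine) :
      Integrable (fun p : ℝ × ℝ => ‖f (p.1 + p.2)‖ * ‖w p.2‖ ^ 2) (halfLine.prod halfLine) :=
    (integrable_shift_mul hf.integrable.norm (hw.integrable_norm_pow two_ne_zero)).mono_measure
      (Measure.prod_mono Measure.restrict_le_self le_rfl)
  refine ((shift_integrable hu).swap.add (shift_integrable hv)).mono'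
    (hu.1.comp_fst.mul (hf.aestronglyMeasurable_shift_mul hv.1.star)) (ae_of_all _ fun p => ?_)
  simp only [Pi.add_apply, Function.comp_apply, Prod.fst_swap, Prod.snd_swap, norm_mul,
    RCLike.norm_conj, add_comm p.2]
  rw [← mul_add, mul_left_comm]
  gcongr
  nlinarith [sq_nonneg (‖u p.1‖ - ‖v p.2‖), sq_nonneg (‖u p.1‖ + ‖v p.2‖)]

lemma hankelCLM_conj (hf : IsWeightedL2 f) : hankelCLM hf.conj = star (hankelCLM hf) := by
  rw [ContinuousLinearMap.star_eq_adjoint, ContinuousLinearMap.eq_adjoint_iff]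
  intro v u
  rw [L2.inner_def, L2.inner_def]
  calc ∫ s, ⟪(hankelCLM hf.conj v) s, u s⟫_ℂ ∂halfLine
      = ∫ s, ∫ t, u s * (f (s + t) * conj (v t)) ∂halfLine ∂halfLine := by
        refine integral_congr_ae ?_
        filter_upwards [hankelCLM_coeFn hf.conj v] with s hs
        rw [hs, integral_const_mul, RCLike.inner_apply, hankel, ← integral_conj]
        simp only [map_mul, conj_conj]
    _ = ∫ t, ∫ s, u s * (f (s + t) * conj (v t)) ∂halfLine ∂halfLine :=
        integral_integral_swap (integrable_mul_shift_mul_conj hf (Lp.memLp u) (Lp.memLp v))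
    _ = ∫ t, ⟪v t, (hankelCLM hf u) t⟫_ℂ ∂halfLine := by
        refine integral_congr_ae ?_
        filter_upwards [hankelCLM_coeFn hf u] with t ht
        rw [ht, RCLike.inner_apply, hankel, ← integral_mul_const]
        simp only [add_comm t, mul_left_comm, mul_assoc]

end HankelOperator

section Marchenko

variable {ι : Type*} [Fintype ι]

lemma isUnit_one_add_sum_mul_star {A : Type*} [CStarAlgebra A] [PartialOrder A] [StarOrderedRing A]
    (a : ι → A) : IsUnit (1 + ∑ i, a i * star (a i)) :=
  CStarAlgebra.isUnit_of_le 1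
    (le_add_of_nonneg_right (Finset.sum_nonneg fun i _ => mul_star_self_nonneg (a i)))
    isStrictlyPositive_one

lemma exists_eq_neg_sum_add_apply {H : Type*} [NormedAddCommGroup H] [InnerProductSpace ℂ H]
    [CompleteSpace H] (A : ι → H →L[ℂ] H) (a b : ι → H) :
    ∃ u, u = -∑ i, (a i + A i (b i + star (A i) u)) := by
  obtain ⟨T, hT⟩ := isUnit_one_add_sum_mul_star A
  refine ⟨(↑T⁻¹ : H →L[ℂ] H) (-∑ i, (a i + A i (b i))), ?_⟩
  set u := (↑T⁻¹ : H →L[ℂ] H) (-∑ i, (a i + A i (b i)))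
  have : (T : H →L[ℂ] H) u = -∑ i, (a i + A i (b i)) :=
    DFunLike.congr_fun (Units.mul_inv T) (-∑ i, (a i + A i (b i)))
  rw [hT] at this
  simp only [add_apply, one_apply_eq_self, sum_apply, mul_apply_eq_comp] at this
  simp only [map_add, ← add_assoc, Finset.sum_add_distrib (f := fun i => a i + A i (b i)), neg_add]
  rw [← this, add_neg_cancel_right]

lemma IsWeightedL2.coeFn_smul_add_hankelCLM {f : ℝ → ℂ} (hf : IsWeightedL2 f) (c : ℂ)
    (V : Lp ℂ 2 halfLine) :
    c • (hf.memLp.restrict (Ioi 0)).toLp + hankelCLM hf V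
      =ᵐ[halfLine] fun s => c * f s + hankel f V s := by
  filter_upwards [Lp.coeFn_add (c • (hf.memLp.restrict (Ioi 0)).toLp) (hankelCLM hf V),
    Lp.coeFn_smul c (hf.memLp.restrict (Ioi 0)).toLp, (hf.memLp.restrict (Ioi 0)).coeFn_toLp,
    hankelCLM_coeFn hf V] with s add_eq smul_eq toLp_eq hankel_eq
  rw [add_eq, Pi.add_apply, smul_eq, Pi.smul_apply, toLp_eq, hankel_eq, smul_eq_mul]

/-- Elimination of the `v i` leaves an equation for `u` with the operator `1 + ∑ H_{f i} H_{f i}*`,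
which is invertible. -/
theorem exists_marchenko {f : ι → ℝ → ℂ} (hf : ∀ i, IsWeightedL2 (f i)) (e : ℂ) (c : ι → ℂ) :
    ∃ (u : ℝ → ℂ) (v : ι → ℝ → ℂ), Integrable u halfLine ∧ (∀ i, Integrable (v i) halfLine) ∧
      (∀ i s, v i s = e * conj (f i s) + hankel (fun s => conj (f i s)) u s) ∧
      ∀ s, u s = -∑ i, (c i * f i s + hankel (f i) (v i) s) := by
  obtain ⟨U, hU⟩ := exists_eq_neg_sum_add_apply (fun i => hankelCLM (hf i))
    (fun i => c i • ((hf i).memLp.restrict (Ioi 0)).toLp)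
    (fun i => e • ((hf i).conj.memLp.restrict (Ioi 0)).toLp)
  simp only [← hankelCLM_conj] at hU
  set V : ι → Lp ℂ 2 halfLine := fun i =>
    e • ((hf i).conj.memLp.restrict (Ioi 0)).toLp + hankelCLM (hf i).conj U
  let v : ι → ℝ → ℂ := fun i s => e * conj (f i s) + hankel (fun s => conj (f i s)) U s
  let u : ℝ → ℂ := fun s => -∑ i, (c i * f i s + hankel (f i) (V i) s)
  have V_eq (i : ι) : V i =ᵐ[halfLine] v i := (hf i).conj.coeFn_smul_add_hankelCLM e U
  have U_eq : U =ᵐ[halfLine] u := by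
    rw [hU]
    filter_upwards [Lp.coeFn_neg (∑ i, (c i • ((hf i).memLp.restrict (Ioi 0)).toLp +
        hankelCLM (hf i) (V i))),
      Lp.coeFn_fun_finsetSum Finset.univ
        (fun i => c i • ((hf i).memLp.restrict (Ioi 0)).toLp + hankelCLM (hf i) (V i)),
      ae_all_iff.2 fun i => (hf i).coeFn_smul_add_hankelCLM (c i) (V i)]
      with s neg_eq sum_eq summand_eq
    rw [neg_eq, Pi.neg_apply, sum_eq, Finset.sum_congr rfl fun i _ => summand_eq i]
  refine ⟨u, v, ?_, fun i => (hf i).conj.integrable_const_mul_add_hankel e (Lp.memLp U),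
    fun i s => ?_, fun s => ?_⟩
  · exact (integrable_finsetSum _ fun i _ =>
      (hf i).integrable_const_mul_add_hankel (c i) (Lp.memLp (V i))).neg
  · rw [← hankel_congr _ U_eq]
  · simp only [u, hankel_congr _ (V_eq _)]

end Marchenko

section RealLine

variable {σ a φ χ u v : ℝ → ℂ} {ι : Type*}

lemma fourierLaplace_neg (a : ℝ → ℂ) : fourierLaplace (-a) = -fourierLaplace a := by
  funext z
  simp only [fourierLaplace, Pi.neg_apply, neg_mul, integral_neg]

lemma isWeightedL2_mul_add_fourierLaplace (hσ : IsWeightedL2 σ) (ha : Integrable a halfLine)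
    (c : ℂ) : IsWeightedL2 fun t : ℝ => σ t * (c + fourierLaplace a (-t)) := by
  have laplace_continuous : Continuous fun t : ℝ => fourierLaplace a (-t) :=
    (continuousOn_fourierLaplace ha).comp_continuous (f := fun t : ℝ => (-t : ℂ)) (by fun_prop)
      fun t => by simp
  refine hσ.of_norm_le (hσ.continuous.mul (continuous_const.add laplace_continuous))
    (‖c‖ + ∫ s in Ioi (0 : ℝ), ‖a s‖) fun t => ?_
  rw [norm_mul, mul_comm]
  gcongr
  exact (norm_add_le _ _).trans (add_le_add_right (norm_fourierLaplace_le ha (by simp)) _)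

lemma fourier_mul_fourierLaplace (hσ : Integrable σ) (ha : Integrable a halfLine) :
    𝓕 (fun t : ℝ => σ t * fourierLaplace a (-t)) = hankel (𝓕 σ) a := by
  funext s
  have integrable_integrand :
      Integrable (fun p : ℝ × ℝ => exp (↑(-2 * Real.pi * p.1 * (s + p.2)) * I) *
        (σ p.1 * a p.2)) (volume.prod halfLine) := by
    have phase_continuous :
        Continuous fun p : ℝ × ℝ => exp (↑(-2 * Real.pi * p.1 * (s + p.2)) * I) := by
      fun_prop
    have prod_integrable := hσ.mul_prod ha
    refine prod_integrable.congr' (phase_continuous.aestronglyMeasurable.mul prod_integrable.1)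
      (ae_of_all _ fun p => ?_)
    simp only [norm_mul, norm_exp_ofReal_mul_I, one_mul]
  have exp_split (t r : ℝ) : exp (↑(-2 * Real.pi * t * (s + r)) * I) =
      exp (↑(-2 * Real.pi * t * s) * I) * exp (2 * Real.pi * I * r * -t) := by
    rw [← exp_add]
    congr 1
    push_cast
    ring
  calc 𝓕 (fun t : ℝ => σ t * fourierLaplace a (-t)) s
      = ∫ t : ℝ, ∫ r in Ioi (0 : ℝ), exp (↑(-2 * Real.pi * t * (s + r)) * I) * (σ t * a r) := by
        rw [Real.fourier_real_eq_integral_exp_smul]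
        simp only [fourierLaplace, smul_eq_mul, ← integral_const_mul, exp_split]
        congr! 4
        ring
    _ = ∫ r in Ioi (0 : ℝ), ∫ t : ℝ, exp (↑(-2 * Real.pi * t * (s + r)) * I) * (σ t * a r) :=
        integral_integral_swap integrable_integrand
    _ = hankel (𝓕 σ) a s := by
        simp only [hankel, Real.fourier_real_eq_integral_exp_smul, ← integral_mul_const,
          smul_eq_mul, mul_assoc]

lemma fourier_mul_add_fourierLaplace (hσ : IsWeightedL2 σ) (ha : Integrable a halfLine) (c : ℂ) :
    𝓕 (fun t : ℝ => σ t * (c + fourierLaplace a (-t))) =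
      fun s => c * 𝓕 σ s + hankel (𝓕 σ) a s := by
  have laplace_integrable : Integrable fun t : ℝ => σ t * fourierLaplace a (-t) := by
    simpa only [zero_add] using (isWeightedL2_mul_add_fourierLaplace hσ ha 0).integrable
  have expand : (fun t : ℝ => σ t * (c + fourierLaplace a (-t))) =
      c • σ + fun t : ℝ => σ t * fourierLaplace a (-t) := by
    funext t
    simp only [mul_add, Pi.add_apply, Pi.smul_apply, smul_eq_mul, mul_comm]
  rw [expand, fourier_add (hσ.integrable.smul c) laplace_integrable, fourier_const_smul,
    fourier_mul_fourierLaplace hσ.integrable ha]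
  rfl

/-- A weighted square integrable function `φ` and its Fourier transform `v`, provided that `v` is
integrable: the jumps which the one-sided transforms of `v` decompose additively. -/
structure IsFourierPair (φ v : ℝ → ℂ) : Prop where
  weighted : IsWeightedL2 φ
  fourier_eq : 𝓕 φ = v
  integrable : Integrable v

lemma IsFourierPair.add (hφ : IsFourierPair φ u) (hχ : IsFourierPair χ v) :
    IsFourierPair (φ + χ) (u + v) :=
  ⟨hφ.weighted.add hχ.weighted, by
    rw [fourier_add hφ.weighted.integrable hχ.weighted.integrable, hφ.fourier_eq, hχ.fourier_eq],
    hφ.integrable.add hχ.integrable⟩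

lemma IsFourierPair.sum {φ v : ι → ℝ → ℂ} (S : Finset ι) (h : ∀ i ∈ S, IsFourierPair (φ i) (v i)) :
    IsFourierPair (∑ i ∈ S, φ i) (∑ i ∈ S, v i) := by
  classical
  induction S using Finset.induction_on with
  | empty =>
    exact ⟨IsRegular.zero.weighted, by simpa using fourier_const_smul 0 (0 : ℝ → ℂ),
      integrable_zero _ _ _⟩
  | insert i S hi ih =>
    rw [Finset.forall_mem_insert] at h
    rw [Finset.sum_insert hi, Finset.sum_insert hi]
    exact h.1.add (ih h.2)

lemma IsFourierPair.decomposition (h : IsFourierPair φ v) :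
    IsDecaying (fourierLaplace v) ∧ IsDecaying (fourierLaplace fun s => v (-s)) ∧
      ∀ t : ℝ, fourierLaplace v t + fourierLaplace (fun s => v (-s)) (-t) = φ t := by
  obtain ⟨weighted, rfl, integrable⟩ := h
  exact ⟨isDecaying_fourierLaplace_fourier weighted integrable,
    isDecaying_fourierLaplace_fourier_neg weighted integrable,
    fourierLaplace_fourier_add_neg weighted.integrable weighted.continuous integrable⟩

lemma IsRegular.isFourierPair_mul_add_fourierLaplace (hσ : IsRegular σ)
    (ha : Integrable a halfLine) (c : ℂ) :
    IsFourierPair (fun t : ℝ => σ t * (c + fourierLaplace a (-t)))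
      (fun s => c * 𝓕 σ s + hankel (𝓕 σ) a s) :=
  ⟨isWeightedL2_mul_add_fourierLaplace hσ.weighted ha c,
    fourier_mul_add_fourierLaplace hσ.weighted ha c,
    (hσ.weighted_fourier.integrable.const_mul c).add
      (integrable_hankel hσ.weighted_fourier.integrable ha)⟩

/-- The Fourier transforms of the two equations are the Marchenko system. -/
theorem exists_row [Fintype ι] {ρ : ι → ℝ → ℂ} (hρ : ∀ i, IsRegular (ρ i)) (c₀ : ℂ) (c : ι → ℂ) :
    ∃ (p₀ m₀ : ℂ → ℂ) (p m : ι → ℂ → ℂ), IsDecaying p₀ ∧ IsDecaying m₀ ∧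
      (∀ i, IsDecaying (p i)) ∧ (∀ i, IsDecaying (m i)) ∧ ∀ t : ℝ,
        (∀ i, p i t = m i (-t) + conj (ρ i t) * (c₀ + m₀ (-t))) ∧
        p₀ t = m₀ (-t) + ∑ i, ρ i t * (c i + p i t) := by
  obtain ⟨u, v, hu, hv, v_eq, u_eq⟩ :=
    exists_marchenko (fun i => (hρ i).comp_neg.weighted_fourier) c₀ c
  have v_pair (i : ι) :
      IsFourierPair (fun t => conj (ρ i t) * (c₀ + fourierLaplace u (-t))) (v i) := by
    convert (hρ i).conj.isFourierPair_mul_add_fourierLaplace hu c₀ using 1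
    funext s
    have fourier_eq : 𝓕 (fun t => conj (ρ i t)) = fun s => conj (𝓕 (fun t => ρ i (-t)) s) := by
      simp only [funext (fourier_conj (ρ i)), fourier_comp_neg]
    rw [v_eq, fourier_eq]
  have u_pair : IsFourierPair (∑ i, fun t => ρ i (-t) * (c i + fourierLaplace (v i) (-t)))
      (-u) := by
    convert IsFourierPair.sum Finset.univ fun i _ =>
      (hρ i).comp_neg.isFourierPair_mul_add_fourierLaplace (hv i) (c i) using 1
    funext s
    rw [Pi.neg_apply, u_eq, neg_neg, Finset.sum_apply]
  obtain ⟨m₀_decaying, p₀_decaying, p₀_add⟩ := u_pair.decomposition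
  simp only [fourierLaplace_neg] at m₀_decaying p₀_add
  choose p_decaying m_decaying p_add using fun i => (v_pair i).decomposition
  refine ⟨_, fourierLaplace u, _, fun i => -fourierLaplace fun s => v i (-s), p₀_decaying,
    by simpa only [neg_neg] using m₀_decaying.neg, p_decaying, fun i => (m_decaying i).neg,
    fun t => ⟨fun i => ?_, ?_⟩⟩
  · simp only [Pi.neg_apply]
    linear_combination p_add i t
  · have p₀_add_neg := p₀_add (-t)
    simp only [Pi.neg_apply, ofReal_neg, neg_neg, Finset.sum_apply] at p₀_add_neg ⊢
    linear_combination p₀_add_neg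

end RealLine

section Removability

variable {F : ℂ → ℂ} {c : ℂ} {r R : ℝ}

lemma integral_boundary_rect_eq_zero_of_im_eq_zero (F_cont : Continuous F)
    (F_diff : ∀ z : ℂ, z.im ≠ 0 → DifferentiableAt ℂ F z) {z w : ℂ} (hzw : z.im = 0 ∨ w.im = 0) :
    (∫ x : ℝ in z.re..w.re, F (x + z.im * I)) - (∫ x : ℝ in z.re..w.re, F (x + w.im * I)) +
      I • (∫ y : ℝ in z.im..w.im, F (w.re + y * I)) -
      I • (∫ y : ℝ in z.im..w.im, F (z.re + y * I)) = 0 := by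
  refine integral_boundary_rect_eq_zero_of_continuousOn_of_differentiableOn F z w
    F_cont.continuousOn fun p hp => (F_diff p fun p_real => ?_).differentiableWithinAt
  have p_im := (mem_reProdIm.1 hp).2
  rcases hzw with h | h <;>
    simp only [p_real, h, mem_Ioo, min_lt_iff, lt_max_iff, lt_irrefl, false_or, or_false]
      at p_im <;>
    exact lt_asymm p_im.1 p_im.2

lemma differentiable_of_continuous_of_im_ne_zero (F_cont : Continuous F)
    (F_diff : ∀ z : ℂ, z.im ≠ 0 → DifferentiableAt ℂ F z) : Differentiable ℂ F := by
  have conservative (z w : ℂ) : wedgeIntegral z w F = -wedgeIntegral w z F := by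
    rw [← add_eq_zero_iff_eq_neg, wedgeIntegral_add_wedgeIntegral_eq]
    have from_z := integral_boundary_rect_eq_zero_of_im_eq_zero F_cont F_diff
      (z := z) (w := w.re) (Or.inr (ofReal_im _))
    have to_w := integral_boundary_rect_eq_zero_of_im_eq_zero F_cont F_diff
      (z := z.re) (w := w) (Or.inl (ofReal_im _))
    have vertical_integrable (x a b : ℝ) :
        IntervalIntegrable (fun y : ℝ => F (x + y * I)) volume a b :=
      Continuous.intervalIntegrable (by fun_prop) a b
    simp only [ofReal_im, ofReal_re, smul_eq_mul] at from_z to_w ⊢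
    rw [← intervalIntegral.integral_add_adjacent_intervals (vertical_integrable w.re z.im 0)
        (vertical_integrable w.re 0 w.im),
      ← intervalIntegral.integral_add_adjacent_intervals (vertical_integrable z.re z.im 0)
        (vertical_integrable z.re 0 w.im)]
    linear_combination from_z + to_w
  intro z
  have exact_near : IsExactOn F (Metric.ball z 1) :=
    IsConservativeOn.isExactOn_ball F_cont.continuousOn fun z w _ => conservative z w
  exact (exact_near.differentiableOn Metric.isOpen_ball).differentiableAt
    (Metric.ball_mem_nhds z one_pos)

lemma circleIntegral_eq_zero_of_differentiableAt_off_sphere (hr : 0 < r) (hrR : r ≤ R) {s : Set ℂ}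
    (hs : s.Countable) (F_cont : ContinuousOn F (Metric.closedBall c R))
    (F_diff : ∀ z ∈ Metric.ball c R, z ∉ Metric.sphere c r → z ∉ s → DifferentiableAt ℂ F z) :
    ∮ z in C(c, R), F z = 0 := by
  rw [circleIntegral_eq_of_differentiable_on_annulus_off_countable hr hrR hs
    (F_cont.mono sdiff_subset) fun z hz => F_diff z hz.1.1
      (fun hz_sphere => hz.1.2 (Metric.sphere_subset_closedBall hz_sphere)) hz.2]
  exact circleIntegral_eq_zero_of_differentiable_on_off_countable hr.le hs
    (F_cont.mono (Metric.closedBall_subset_closedBall hrR)) fun z hz =>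
      F_diff z (Metric.ball_subset_ball hrR hz.1) (Metric.mem_ball.1 hz.1).ne hz.2

lemma circleIntegral_sub_inv_smul_of_differentiableAt_off_sphere (hr : 0 < r) (hrR : r ≤ R)
    (F_cont : ContinuousOn F (Metric.closedBall c R))
    (F_diff : ∀ z ∈ Metric.ball c R, z ∉ Metric.sphere c r → DifferentiableAt ℂ F z) {w : ℂ}
    (hw : w ∈ Metric.ball c R) (hw_sphere : w ∉ Metric.sphere c r) :
    ∮ z in C(c, R), (z - w)⁻¹ • F z = (2 * Real.pi * I : ℂ) • F w := by
  have hR : 0 ≤ R := hr.le.trans hrR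
  have closedBall_mem : Metric.closedBall c R ∈ 𝓝 w :=
    mem_of_superset (Metric.isOpen_ball.mem_nhds hw) Metric.ball_subset_closedBall
  have dslope_integral : ∮ z in C(c, R), dslope F w z = 0 :=
    circleIntegral_eq_zero_of_differentiableAt_off_sphere hr hrR (countable_singleton w)
      ((continuousOn_dslope closedBall_mem).2 ⟨F_cont, F_diff w hw hw_sphere⟩)
      fun z hz hz_sphere hzw => (differentiableAt_dslope_of_ne hzw).2 (F_diff z hz hz_sphere)
  have ne_of_sphere : ∀ z ∈ Metric.sphere c R, z ≠ w := by
    rintro z hz rfl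
    exact (Metric.mem_ball.1 hw).ne hz
  have inv_cont : ContinuousOn (fun z => (z - w)⁻¹) (Metric.sphere c R) :=
    (continuousOn_id.sub continuousOn_const).inv₀ fun z hz => sub_ne_zero.2 (ne_of_sphere z hz)
  rw [← circleIntegral.integral_sub_inv_of_mem_ball hw, ← circleIntegral.integral_smul_const,
    ← sub_eq_zero, ← circleIntegral.integral_sub
      ((inv_cont.fun_smul (F_cont.mono Metric.sphere_subset_closedBall)).circleIntegrable hR)
      ((inv_cont.fun_smul continuousOn_const).circleIntegrable hR), ← dslope_integral]
  refine circleIntegral.integral_congr hR fun z hz => ?_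
  simp only [dslope_of_ne _ (ne_of_sphere z hz), slope_def_module, smul_sub]

lemma differentiableOn_ball_of_differentiableAt_off_sphere (hr : 0 < r) (hrR : r < R)
    (F_cont : ContinuousOn F (Metric.closedBall c R))
    (F_diff : ∀ z ∈ Metric.ball c R, z ∉ Metric.sphere c r → DifferentiableAt ℂ F z) :
    DifferentiableOn ℂ F (Metric.ball c R) := by
  have hR : 0 < R := hr.trans hrR
  lift R to NNReal using hR.le
  set H : ℂ → ℂ := fun w => (2 * Real.pi * I : ℂ)⁻¹ • ∮ z in C(c, R), (z - w)⁻¹ • F z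
  have H_diff : DifferentiableOn ℂ H (Metric.ball c R) := by
    have F_integrable : CircleIntegrable F c R :=
      (F_cont.mono Metric.sphere_subset_closedBall).circleIntegrable hR.le
    simpa only [Metric.eball_coe] using
      (hasFPowerSeriesOn_cauchy_integral F_integrable hR).differentiableOn
  have F_eq_off_sphere : ∀ w ∈ Metric.ball c R ∩ (Metric.sphere c r)ᶜ, F w = H w := by
    intro w hw
    simp only [H]
    rw [circleIntegral_sub_inv_smul_of_differentiableAt_off_sphere hr hrR.le F_cont F_diff
      hw.1 hw.2, inv_smul_smul₀ two_pi_I_ne_zero]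
  have dense_compl_sphere : Dense (Metric.sphere c r)ᶜ := by
    rw [← interior_eq_empty_iff_dense_compl, interior_sphere c hr.ne']
  exact H_diff.congr <| EqOn.of_subset_closure F_eq_off_sphere
    (F_cont.mono Metric.ball_subset_closedBall) H_diff.continuousOn inter_subset_left
    (dense_compl_sphere.open_subset_closure_inter Metric.isOpen_ball)

lemma differentiableAt_of_mem_sphere (F_cont : Continuous F) (hr : 0 < r) {V : Set ℂ}
    (hV : IsOpen V) (ball_subset : Metric.closedBall c r ⊆ V)
    (F_diff : ∀ z ∈ V, z ∉ Metric.sphere c r → DifferentiableAt ℂ F z) {w : ℂ}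
    (hw : w ∈ Metric.sphere c r) : DifferentiableAt ℂ F w := by
  obtain ⟨δ, hδ, hsub⟩ := (isCompact_closedBall c r).exists_cthickening_subset_open hV ball_subset
  rw [cthickening_closedBall hδ.le hr.le] at hsub
  have hw_ball : w ∈ Metric.ball c (δ + r) := by
    rw [Metric.mem_ball, Metric.mem_sphere.1 hw]
    linarith
  exact (differentiableOn_ball_of_differentiableAt_off_sphere hr (by linarith) F_cont.continuousOn
    fun z hz hz_sphere => F_diff z (hsub (Metric.ball_subset_closedBall hz))
      hz_sphere).differentiableAt (Metric.isOpen_ball.mem_nhds hw_ball)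

lemma differentiableAt_of_pairwise_disjoint_closedBall {ι : Type*} [Finite ι] {c : ι → ℂ}
    {r : ι → ℝ} (hr : ∀ i, 0 < r i)
    (disjoint : Pairwise (Disjoint on fun i => Metric.closedBall (c i) (r i)))
    (F_cont : Continuous F) {U : Set ℂ} (hU : IsOpen U)
    (ball_subset : ∀ i, Metric.closedBall (c i) (r i) ⊆ U)
    (F_diff : ∀ z ∈ U, (∀ i, z ∉ Metric.sphere (c i) (r i)) → DifferentiableAt ℂ F z) {w : ℂ}
    (hw : w ∈ U) : DifferentiableAt ℂ F w := by
  by_cases h : ∃ i, w ∈ Metric.sphere (c i) (r i)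
  · obtain ⟨i, hi⟩ := h
    have isClosed_others : IsClosed (⋃ j : {j // j ≠ i}, Metric.closedBall (c j) (r j)) :=
      isClosed_iUnion_of_finite fun _ => Metric.isClosed_closedBall
    refine differentiableAt_of_mem_sphere F_cont (hr i) (hU.sdiff isClosed_others)
      (subset_sdiff.2 ⟨ball_subset i, disjoint_iUnion_right.2 fun j => disjoint j.2.symm⟩)
      (fun z hz hzi => F_diff z hz.1 fun j hzj => ?_) hi
    by_cases hji : j = i
    · exact hzi (hji ▸ hzj)
    · exact hz.2 (mem_iUnion.2 ⟨⟨j, hji⟩, Metric.sphere_subset_closedBall hzj⟩)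
  · exact F_diff w hw (not_exists.1 h)

end Removability

section NoJump

variable {X Y : Type*} [TopologicalSpace X] [TopologicalSpace Y] {S : Set X} {f g : X → Y}

lemma continuous_piecewise_of_tendsto [DecidablePred (· ∈ S)] (hS : IsClosed S)
    (hf : ContinuousOn f Sᶜ) (hg : ContinuousOn g S)
    (tendsto_g : ∀ l ∈ S, Tendsto f (𝓝[Sᶜ] l) (𝓝 (g l))) : Continuous (S.piecewise g f) := by
  rw [continuous_iff_continuousAt]
  intro l
  by_cases hl : l ∈ S
  · have on_S : Tendsto (S.piecewise g f) (𝓝[S] l) (𝓝 (g l)) :=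
      (hg l hl).congr' ((piecewise_eqOn S g f).symm.eventuallyEq_of_mem self_mem_nhdsWithin)
    have on_compl : Tendsto (S.piecewise g f) (𝓝[Sᶜ] l) (𝓝 (g l)) :=
      (tendsto_g l hl).congr'
        ((piecewise_eqOn_compl S g f).symm.eventuallyEq_of_mem self_mem_nhdsWithin)
    rw [ContinuousAt, piecewise_eq_of_mem _ _ _ hl, ← nhdsWithin_univ, ← union_compl_self S,
      nhdsWithin_union]
    exact on_S.sup on_compl
  · have compl_mem : Sᶜ ∈ 𝓝 l := hS.isOpen_compl.mem_nhds hl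
    exact (hf.continuousAt compl_mem).congr
      ((piecewise_eqOn_compl S g f).symm.eventuallyEq_of_mem compl_mem)

lemma tendsto_of_tendsto_inf_principal_of_dense [RegularSpace Y] {ι : Type*} {p : ι → Prop}
    {s : ι → Set X} {l : Filter X} (hl : l.HasBasis p s) (hs : ∀ i, p i → IsOpen (s i))
    (hS : Dense S) (hf : Continuous f) {c : Y} (tendsto_on_S : Tendsto f (l ⊓ 𝓟 S) (𝓝 c)) :
    Tendsto f l (𝓝 c) := by
  rw [(closed_nhds_basis c).tendsto_right_iff]
  rintro V ⟨V_mem, V_closed⟩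
  obtain ⟨i, hi, s_inter_subset⟩ :=
    (hl.inf_principal S).mem_iff.1 (tendsto_on_S V_mem)
  exact mem_of_superset (hl.mem_of_mem hi) <| (hS.open_subset_closure_inter (hs i hi)).trans
    (closure_minimal s_inter_subset (V_closed.preimage hf))

end NoJump

section Contour

lemma dist_conj_left (a b : ℂ) : dist (conj a) b = dist a (conj b) := by
  rw [dist_eq_norm, dist_eq_norm, ← Complex.norm_conj, map_sub, conj_conj]

lemma im_pos_of_dist_le {c w : ℂ} {r : ℝ} (hc : r < c.im) (hw : dist w c ≤ r) : 0 < w.im := by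
  have im_sub_le := (le_abs_self _).trans (abs_im_le_norm (c - w))
  rw [← dist_eq_norm, dist_comm, sub_im] at im_sub_le
  linarith

lemma im_neg_of_dist_conj_le {c w : ℂ} {r : ℝ} (hc : r < c.im) (hw : dist w (conj c) ≤ r) :
    w.im < 0 := by
  rw [← dist_conj_left] at hw
  simpa using im_pos_of_dist_le hc hw

lemma lt_dist_of_dist_le {a b w : ℂ} {r s : ℝ} (hab : r + s < dist a b) (hw : dist w a ≤ r) :
    s < dist w b := by
  linarith [dist_triangle_left a b w]

variable {n : ℕ} {z : Fin n → ℂ} {r : Fin n → ℝ} {w : ℂ}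

/-- The closed discs bounded by the circles `γ_i` lie in the open upper half-plane and are pairwise
disjoint. -/
structure IsSeparated (z : Fin n → ℂ) (r : Fin n → ℝ) : Prop where
  radius_pos : ∀ i, 0 < r i
  radius_lt_im : ∀ i, r i < (z i).im
  radius_add_lt_dist : ∀ i j, i ≠ j → r i + r j < dist (z i) (z j)

lemma mem_contour : w ∈ contour z r ↔ w.im = 0 ∨ (∃ i, dist w (z i) = r i) ∨
    ∃ i, dist w (conj (z i)) = r i := by
  simp only [contour, mem_union, mem_ofPred_eq, mem_iUnion, Metric.mem_sphere, or_assoc]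

lemma mem_plusSide : w ∈ plusSide z r ↔ (0 < w.im ∧ ∀ i, r i < dist w (z i)) ∨
    ∃ i, dist w (conj (z i)) < r i := by
  simp only [plusSide, mem_union, mem_ofPred_eq, mem_iUnion, Metric.mem_ball]

lemma mem_minusSide : w ∈ minusSide z r ↔ (w.im < 0 ∧ ∀ i, r i < dist w (conj (z i))) ∨
    ∃ i, dist w (z i) < r i := by
  simp only [minusSide, mem_union, mem_ofPred_eq, mem_iUnion, Metric.mem_ball]

lemma conj_mem_contour : conj w ∈ contour z r ↔ w ∈ contour z r := by
  simp only [mem_contour, dist_conj_left, conj_conj, conj_im, neg_eq_zero]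
  tauto

lemma conj_mem_plusSide : conj w ∈ plusSide z r ↔ w ∈ minusSide z r := by
  simp only [mem_plusSide, mem_minusSide, dist_conj_left, conj_conj, conj_im, Left.neg_pos_iff]

lemma isClosed_contour : IsClosed (contour z r) :=
  ((isClosed_eq continuous_im continuous_const).union
    (isClosed_iUnion_of_finite fun _ => Metric.isClosed_sphere)).union
    (isClosed_iUnion_of_finite fun _ => Metric.isClosed_sphere)

lemma compl_contour_subset : (contour z r)ᶜ ⊆ plusSide z r ∪ minusSide z r := by
  intro w hw
  rw [mem_compl_iff, mem_contour] at hw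
  push Not at hw
  obtain ⟨im_ne, dist_ne, dist_conj_ne⟩ := hw
  simp only [mem_union, mem_plusSide, mem_minusSide]
  by_cases in_ball : ∃ i, dist w (z i) < r i
  · exact Or.inr (Or.inr in_ball)
  by_cases in_conj_ball : ∃ i, dist w (conj (z i)) < r i
  · exact Or.inl (Or.inr in_conj_ball)
  push Not at in_ball in_conj_ball
  rcases lt_or_gt_of_ne im_ne with im_neg | im_pos
  · exact Or.inr (Or.inl ⟨im_neg, fun i => (in_conj_ball i).lt_of_ne (dist_conj_ne i).symm⟩)
  · exact Or.inl (Or.inl ⟨im_pos, fun i => (in_ball i).lt_of_ne (dist_ne i).symm⟩)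

lemma plusSide_subset_compl_contour (hsep : IsSeparated z r) :
    plusSide z r ⊆ (contour z r)ᶜ := by
  intro w hw
  rw [mem_compl_iff, mem_contour]
  push Not
  rcases mem_plusSide.1 hw with ⟨im_pos, lt_dist⟩ | ⟨i, hi⟩
  · exact ⟨im_pos.ne', fun i => (lt_dist i).ne',
      fun i h => (im_neg_of_dist_conj_le (hsep.radius_lt_im i) h.le).not_gt im_pos⟩
  · have im_neg := im_neg_of_dist_conj_le (hsep.radius_lt_im i) hi.le
    refine ⟨im_neg.ne, fun j h => (im_pos_of_dist_le (hsep.radius_lt_im j) h.le).not_gt im_neg,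
      fun j h => ?_⟩
    by_cases hij : i = j
    · subst hij
      exact hi.ne h
    · rw [← dist_conj_left] at h hi
      exact (lt_dist_of_dist_le (hsep.radius_add_lt_dist i j hij) hi.le).ne' h

lemma pairwise_disjoint_closedBall_elim_conj (hsep : IsSeparated z r) :
    Pairwise (Disjoint on fun i : Fin n ⊕ Fin n =>
      Metric.closedBall (Sum.elim z (fun i => conj (z i)) i) (Sum.elim r r i)) := by
  have disjoint_conj (i j : Fin n) :
      Disjoint (Metric.closedBall (z i) (r i)) (Metric.closedBall (conj (z j)) (r j)) :=
    disjoint_left.2 fun w hi hj =>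
      (im_neg_of_dist_conj_le (hsep.radius_lt_im j) hj).not_gt
        (im_pos_of_dist_le (hsep.radius_lt_im i) hi)
  rintro (i | i) (j | j) hij
  · exact Metric.closedBall_disjoint_closedBall
      (hsep.radius_add_lt_dist i j fun h => hij (congrArg Sum.inl h))
  · exact disjoint_conj i j
  · exact (disjoint_conj j i).symm
  · refine Metric.closedBall_disjoint_closedBall ?_
    simpa only [Sum.elim_inr, dist_conj_conj] using
      hsep.radius_add_lt_dist i j fun h => hij (congrArg Sum.inr h)

lemma contour_subset_closure_plusSide (hsep : IsSeparated z r) :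
    contour z r ⊆ closure (plusSide z r) := by
  intro l hl
  rcases mem_contour.1 hl with l_real | ⟨i, hi⟩ | ⟨i, hi⟩
  · have isClosed_balls : IsClosed (⋃ i, Metric.closedBall (z i) (r i)) :=
      isClosed_iUnion_of_finite fun _ => Metric.isClosed_closedBall
    have l_mem : l ∈ closure {w : ℂ | 0 < w.im} := by
      rw [closure_setOfPred_lt_im]
      exact l_real.ge
    refine closure_mono
      (fun w hw => mem_plusSide.2 (Or.inl ⟨hw.2, fun i => not_le.1 fun h =>
        hw.1 (mem_iUnion.2 ⟨i, h⟩)⟩))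
      (isClosed_balls.isOpen_compl.inter_closure ⟨fun h => ?_, l_mem⟩)
    obtain ⟨i, hi⟩ := mem_iUnion.1 h
    exact (im_pos_of_dist_le (hsep.radius_lt_im i) hi).ne' l_real
  · have isClosed_others : IsClosed (⋃ j : {j // j ≠ i}, Metric.closedBall (z j) (r j)) :=
      isClosed_iUnion_of_finite fun _ => Metric.isClosed_closedBall
    have l_mem : l ∈ closure (Metric.closedBall (z i) (r i))ᶜ := by
      rw [closure_compl, interior_closedBall _ (hsep.radius_pos i).ne']
      exact fun h => (Metric.mem_ball.1 h).ne hi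
    refine closure_mono
      (fun w hw => mem_plusSide.2 (Or.inl ⟨hw.1.1, fun j => not_le.1 fun h => ?_⟩))
      (((isOpen_lt continuous_const continuous_im).sdiff isClosed_others).inter_closure
        ⟨⟨im_pos_of_dist_le (hsep.radius_lt_im i) hi.le, fun h => ?_⟩, l_mem⟩)
    · by_cases hji : j = i
      · exact hw.2 (hji ▸ h)
      · exact hw.1.2 (mem_iUnion.2 ⟨⟨j, hji⟩, h⟩)
    · obtain ⟨j, hj⟩ := mem_iUnion.1 h
      exact (lt_dist_of_dist_le (hsep.radius_add_lt_dist i j j.2.symm) hi.le).not_ge hj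
  · have l_mem : l ∈ closure (Metric.ball (conj (z i)) (r i)) := by
      rw [closure_ball _ (hsep.radius_pos i).ne']
      exact hi.le
    exact closure_mono (fun w hw => mem_plusSide.2 (Or.inr ⟨i, hw⟩)) l_mem

lemma contour_subset_closure_minusSide (hsep : IsSeparated z r) :
    contour z r ⊆ closure (minusSide z r) := by
  intro l hl
  have conj_mem := contour_subset_closure_plusSide hsep (conj_mem_contour.2 hl)
  have l_mem := image_closure_subset_closure_image continuous_conj (mem_image_of_mem _ conj_mem)
  rw [conj_conj] at l_mem
  refine closure_mono ?_ l_mem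
  rintro _ ⟨w, hw, rfl⟩
  rwa [← conj_mem_plusSide, conj_conj]

lemma dense_compl_contour (hsep : IsSeparated z r) : Dense (contour z r)ᶜ := by
  intro l
  by_cases hl : l ∈ contour z r
  · exact closure_mono (plusSide_subset_compl_contour hsep)
      (contour_subset_closure_plusSide hsep hl)
  · exact subset_closure hl

lemma differentiable_of_differentiableOn_compl_contour (hsep : IsSeparated z r)
    {F : ℂ → ℂ} (F_cont : Continuous F) (F_diff : DifferentiableOn ℂ F (contour z r)ᶜ) :
    Differentiable ℂ F := by
  refine differentiable_of_continuous_of_im_ne_zero F_cont fun w hw =>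
    differentiableAt_of_pairwise_disjoint_closedBall (Sum.rec hsep.radius_pos hsep.radius_pos)
      (pairwise_disjoint_closedBall_elim_conj hsep) F_cont (U := {w | w.im ≠ 0})
      (isOpen_ne_fun continuous_im continuous_const) ?_ (fun v v_im hv =>
        F_diff.differentiableAt (isClosed_contour.isOpen_compl.mem_nhds fun hvc => ?_)) hw
  · rintro (i | i) v hv
    · exact (im_pos_of_dist_le (hsep.radius_lt_im i) hv).ne'
    · exact (im_neg_of_dist_conj_le (hsep.radius_lt_im i) hv).ne
  · rcases mem_contour.1 hvc with v_real | ⟨i, hi⟩ | ⟨i, hi⟩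
    · exact v_im v_real
    · exact hv (Sum.inl i) hi
    · exact hv (Sum.inr i) hi

lemma eq_const_of_no_jump (hsep : IsSeparated z r) {f g : ℂ → ℂ} {c : ℂ}
    (hf : DifferentiableOn ℂ f (contour z r)ᶜ)
    (hg : ContinuousOn g (contour z r))
    (tendsto_plus : ∀ l ∈ contour z r, Tendsto f (𝓝[plusSide z r] l) (𝓝 (g l)))
    (tendsto_minus : ∀ l ∈ contour z r, Tendsto f (𝓝[minusSide z r] l) (𝓝 (g l)))
    (tendsto_infty : Tendsto f (cobounded ℂ ⊓ 𝓟 (contour z r)ᶜ) (𝓝 c)) :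
    ∀ w ∈ (contour z r)ᶜ, f w = c := by
  classical
  set F : ℂ → ℂ := (contour z r).piecewise g f
  have F_eq : EqOn F f (contour z r)ᶜ := piecewise_eqOn_compl _ _ _
  have F_cont : Continuous F := continuous_piecewise_of_tendsto isClosed_contour hf.continuousOn hg
    fun l hl => by
      refine Tendsto.mono_left ?_ (nhdsWithin_mono l compl_contour_subset)
      rw [nhdsWithin_union]
      exact (tendsto_plus l hl).sup (tendsto_minus l hl)
  have F_diff : Differentiable ℂ F :=
    differentiable_of_differentiableOn_compl_contour hsep F_cont (hf.congr F_eq)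
  have F_tendsto : Tendsto F (cocompact ℂ) (𝓝 c) := by
    rw [← Metric.cobounded_eq_cocompact]
    exact tendsto_of_tendsto_inf_principal_of_dense
      (Metric.hasBasis_cobounded_compl_closedBall (0 : ℂ))
      (fun R _ => Metric.isClosed_closedBall.isOpen_compl) (dense_compl_contour hsep) F_cont
      (tendsto_infty.congr'
        (F_eq.symm.eventuallyEq_of_mem (mem_inf_of_right (mem_principal_self _))))
  intro w hw
  rw [← F_eq hw, F_diff.eq_const_of_tendsto_cocompact F_tendsto]
  rfl

end Contour

section Adjugate

variable {m : Type*} [Fintype m] [DecidableEq m] {M : ℂ → Matrix m m ℂ} {s : Set ℂ}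

lemma differentiableOn_det (hM : ∀ i j, DifferentiableOn ℂ (fun w => M w i j) s) :
    DifferentiableOn ℂ (fun w => (M w).det) s := by
  simp only [Matrix.det_apply']
  fun_prop

lemma differentiableOn_adjugate_apply (hM : ∀ i j, DifferentiableOn ℂ (fun w => M w i j) s)
    (i j : m) : DifferentiableOn ℂ (fun w => (M w).adjugate i j) s := by
  simp only [Matrix.adjugate_apply]
  refine differentiableOn_det fun k l => ?_
  by_cases hk : k = j
  · simp only [Matrix.updateRow_apply, hk, if_true]
    exact differentiableOn_const _
  · simpa only [Matrix.updateRow_apply, hk, if_false] using hM k l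

lemma tendsto_mul_adjugate_apply {X : Type*} {l : Filter X} {A B : X → Matrix m m ℂ}
    {a b : Matrix m m ℂ} (hA : Tendsto A l (𝓝 a)) (hB : Tendsto B l (𝓝 b)) (i j : m) :
    Tendsto (fun w => (A w * (B w).adjugate) i j) l (𝓝 ((a * b.adjugate) i j)) := by
  have mul_adjugate_continuous :
      Continuous fun P : Matrix m m ℂ × Matrix m m ℂ => (P.1 * P.2.adjugate) i j :=
    (continuous_fst.matrix_mul continuous_snd.matrix_adjugate).matrix_elem i j
  simpa only [Function.comp_def] using
    (mul_adjugate_continuous.tendsto (a, b)).comp (hA.prodMk_nhds hB)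

end Adjugate

section Uniqueness

lemma expSig_mul_expSig_neg (x : ℝ) (l : ℂ) : expSig x l * expSig x (-l) = 1 := by
  rw [expSig, expSig, Matrix.diagonal_mul_diagonal, ← Matrix.diagonal_one]
  congr 1
  ext j
  rw [← Complex.exp_add, ← Complex.exp_zero]
  congr 1
  ring

lemma det_expAd (x : ℝ) (l : ℂ) (B : Matrix (Fin 3) (Fin 3) ℂ) : (expAd x l B).det = B.det := by
  rw [expAd, Matrix.det_mul, Matrix.det_mul, mul_right_comm, ← Matrix.det_mul,
    expSig_mul_expSig_neg, Matrix.det_one, one_mul]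

lemma det_jumpReal (a b : ℂ) : (jumpReal a b).det = 1 := by
  simp only [jumpReal, Matrix.det_fin_three, Matrix.of_apply, Matrix.cons_val]
  push_cast
  rw [← Complex.conj_mul', ← Complex.conj_mul']
  ring

lemma det_jumpUp (w : ℂ) (c : Fin 2 → ℂ) (l : ℂ) : (jumpUp w c l).det = 1 := by
  simp [jumpUp, Matrix.det_fin_three]

lemma det_jumpDown (w : ℂ) (c : Fin 2 → ℂ) (l : ℂ) : (jumpDown w c l).det = 1 := by
  simp [jumpDown, Matrix.det_fin_three]

variable {n : ℕ} {z : Fin n → ℂ} {r : Fin n → ℝ} {x : ℝ} {ρ₁ ρ₂ : ℝ → ℂ} {C : Fin n → Fin 2 → ℂ}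
  {M M' : ℂ → Matrix (Fin 3) (Fin 3) ℂ} {l : ℂ} {V : Matrix (Fin 3) (Fin 3) ℂ}

/-- `IsJump x ρ₁ ρ₂ z r C l V` says that `V` is the jump matrix `e^{i l x ad σ} V(l)` prescribed at
the point `l` of `Γ`. It is a relation because `Γ` is a union of curves that a point may belong to
several of. -/
inductive IsJump (x : ℝ) (ρ₁ ρ₂ : ℝ → ℂ) (z : Fin n → ℂ) (r : Fin n → ℝ) (C : Fin n → Fin 2 → ℂ) :
    ℂ → Matrix (Fin 3) (Fin 3) ℂ → Prop
  | real (t : ℝ) : IsJump x ρ₁ ρ₂ z r C t (expAd x t (jumpReal (ρ₁ t) (ρ₂ t)))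
  | up (i : Fin n) (l : ℂ) (hl : l ∈ Metric.sphere (z i) (r i)) :
      IsJump x ρ₁ ρ₂ z r C l (expAd x l (jumpUp (z i) (C i) l))
  | down (i : Fin n) (l : ℂ) (hl : l ∈ Metric.sphere (conj (z i)) (r i)) :
      IsJump x ρ₁ ρ₂ z r C l (expAd x l (jumpDown (z i) (C i) l))

lemma IsJump.det_eq_one (hV : IsJump x ρ₁ ρ₂ z r C l V) : V.det = 1 := by
  cases hV <;> simp only [det_expAd, det_jumpReal, det_jumpUp, det_jumpDown]

lemma exists_isJump (hl : l ∈ contour z r) : ∃ V, IsJump x ρ₁ ρ₂ z r C l V := by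
  rcases mem_contour.1 hl with l_real | ⟨i, hi⟩ | ⟨i, hi⟩
  · obtain ⟨t, rfl⟩ : ∃ t : ℝ, (t : ℂ) = l := ⟨l.re, Complex.ext rfl l_real.symm⟩
    exact ⟨_, .real t⟩
  · exact ⟨_, .up i l hi⟩
  · exact ⟨_, .down i l hi⟩

lemma IsSolution.exists_boundaryValues (h : IsSolution x ρ₁ ρ₂ z r C M) :
    ∃ Mp Mm : ℂ → Matrix (Fin 3) (Fin 3) ℂ, ContinuousOn Mp (contour z r) ∧
      (∀ l ∈ contour z r, Tendsto M (𝓝[plusSide z r] l) (𝓝 (Mp l))) ∧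
      (∀ l ∈ contour z r, Tendsto M (𝓝[minusSide z r] l) (𝓝 (Mm l))) ∧
      ∀ l V, IsJump x ρ₁ ρ₂ z r C l V → Mp l = Mm l * V := by
  obtain ⟨Mp, Mm, Mp_cont, -, tendsto_Mp, tendsto_Mm, jump_real, jump_up, jump_down⟩ := h.jump
  refine ⟨Mp, Mm, Mp_cont, tendsto_Mp, tendsto_Mm, fun l V hV => ?_⟩
  cases hV with
  | real t => exact jump_real t
  | up i _ hl => exact jump_up i _ hl
  | down i _ hl => exact jump_down i _ hl

lemma IsSolution.det_eq_one (hsep : IsSeparated z r) (h : IsSolution x ρ₁ ρ₂ z r C M) :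
    ∀ w ∈ (contour z r)ᶜ, (M w).det = 1 := by
  obtain ⟨Mp, Mm, Mp_cont, tendsto_Mp, tendsto_Mm, jump⟩ := h.exists_boundaryValues
  have det_cont : Continuous fun A : Matrix (Fin 3) (Fin 3) ℂ => A.det :=
    continuous_id.matrix_det
  refine eq_const_of_no_jump hsep (f := fun w => (M w).det) (g := fun w => (Mp w).det)
      (differentiableOn_det h.analytic)
    (det_cont.comp_continuousOn Mp_cont) (fun l hl => (det_cont.tendsto _).comp (tendsto_Mp l hl))
    (fun l hl => ?_) ?_
  · obtain ⟨V, hV⟩ := exists_isJump hl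
    rw [jump l V hV, Matrix.det_mul, hV.det_eq_one, mul_one]
    exact (det_cont.tendsto _).comp (tendsto_Mm l hl)
  · simpa only [Matrix.det_one, Function.comp_def] using (det_cont.tendsto 1).comp h.tendsto_one

lemma IsSolution.mul_adjugate_eq_one (hsep : IsSeparated z r) (h : IsSolution x ρ₁ ρ₂ z r C M)
    (h' : IsSolution x ρ₁ ρ₂ z r C M') {w : ℂ} (hw : w ∈ (contour z r)ᶜ) :
    M' w * (M w).adjugate = 1 := by
  obtain ⟨Mp, Mm, Mp_cont, tendsto_Mp, tendsto_Mm, jump⟩ := h.exists_boundaryValues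
  obtain ⟨Mp', Mm', Mp'_cont, tendsto_Mp', tendsto_Mm', jump'⟩ := h'.exists_boundaryValues
  have no_jump : ∀ l ∈ contour z r, Mp' l * (Mp l).adjugate = Mm' l * (Mm l).adjugate := by
    intro l hl
    obtain ⟨V, hV⟩ := exists_isJump hl
    rw [jump l V hV, jump' l V hV, Matrix.adjugate_mul_distrib, Matrix.mul_assoc,
      ← Matrix.mul_assoc V, Matrix.mul_adjugate, hV.det_eq_one, one_smul, Matrix.one_mul]
  ext i j
  refine eq_const_of_no_jump hsep (f := fun w => (M' w * (M w).adjugate) i j)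
    (g := fun w => (Mp' w * (Mp w).adjugate) i j) ?_
    (fun l hl => tendsto_mul_adjugate_apply (Mp'_cont l hl) (Mp_cont l hl) i j)
    (fun l hl => tendsto_mul_adjugate_apply (tendsto_Mp' l hl) (tendsto_Mp l hl) i j)
    (fun l hl => ?_) ?_ w hw
  · simp only [Matrix.mul_apply]
    exact DifferentiableOn.fun_sum fun k _ =>
      (h'.analytic i k).mul (differentiableOn_adjugate_apply h.analytic k j)
  · rw [no_jump l hl]
    exact tendsto_mul_adjugate_apply (tendsto_Mm' l hl) (tendsto_Mm l hl) i j
  · simpa only [Matrix.adjugate_one, Matrix.mul_one] using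
      tendsto_mul_adjugate_apply h'.tendsto_one h.tendsto_one i j

theorem IsSolution.eqOn (hsep : IsSeparated z r) (h : IsSolution x ρ₁ ρ₂ z r C M)
    (h' : IsSolution x ρ₁ ρ₂ z r C M') : EqOn M' M (contour z r)ᶜ := by
  intro w hw
  calc M' w = M' w * ((M w).adjugate * M w) := by
        rw [Matrix.adjugate_mul, h.det_eq_one hsep w hw, one_smul, Matrix.mul_one]
    _ = M w := by
        rw [← Matrix.mul_assoc, IsSolution.mul_adjugate_eq_one hsep h h' hw, Matrix.one_mul]

end Uniqueness

section JumpMatrices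

/-- The nilpotent matrix with first column `(0, c)`, the exponent of the triangular factors of the
jump matrices. -/
def lowerBlock : (Fin 2 → ℂ) →ₗ[ℂ] Matrix (Fin 3) (Fin 3) ℂ where
  toFun c := !![0, 0, 0; c 0, 0, 0; c 1, 0, 0]
  map_add' c d := by ext i j; fin_cases i <;> fin_cases j <;> simp
  map_smul' a c := by ext i j; fin_cases i <;> fin_cases j <;> simp

lemma lowerBlock_mul_lowerBlock (c d : Fin 2 → ℂ) : lowerBlock c * lowerBlock d = 0 := by
  ext i j
  fin_cases i <;> fin_cases j <;> simp [lowerBlock, Matrix.mul_apply, Fin.sum_univ_three]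

lemma one_add_lowerBlock_mul (c d : Fin 2 → ℂ) :
    (1 + lowerBlock c) * (1 + lowerBlock d) = 1 + lowerBlock (c + d) := by
  simp only [add_mul, mul_add, one_mul, mul_one, lowerBlock_mul_lowerBlock, map_add, add_zero]
  abel

lemma jumpUp_eq (w : ℂ) (c : Fin 2 → ℂ) (l : ℂ) :
    jumpUp w c l = 1 + lowerBlock ((l - w)⁻¹ • c) := by
  ext i j
  fin_cases i <;> fin_cases j <;> simp [jumpUp, lowerBlock, div_eq_inv_mul]

lemma jumpDown_eq_conjTranspose (w : ℂ) (c : Fin 2 → ℂ) (l : ℂ) :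
    jumpDown w c l = (jumpUp w c (conj l)).conjTranspose := by
  ext i j
  fin_cases i <;> fin_cases j <;> simp [jumpUp, jumpDown]

lemma jumpReal_eq (c : Fin 2 → ℂ) :
    jumpReal (c 0) (c 1) = (1 + lowerBlock c).conjTranspose * (1 + lowerBlock c) := by
  ext i j
  fin_cases i <;> fin_cases j <;>
    simp [jumpReal, lowerBlock, Matrix.mul_apply, Fin.sum_univ_three, Complex.conj_mul']

lemma conjTranspose_expSig (x : ℝ) (l : ℂ) : (expSig x l).conjTranspose = expSig x (-conj l) := by
  rw [expSig, Matrix.diagonal_conjTranspose, expSig]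
  congr 1
  ext j
  have conj_sig : conj (sig j) = sig j := by fin_cases j <;> simp [sig]
  simp only [Pi.star_apply, RCLike.star_def, ← Complex.exp_conj, map_mul, conj_I, conj_ofReal,
    conj_sig]
  congr 1
  ring

lemma conjTranspose_expAd (x : ℝ) (l : ℂ) (B : Matrix (Fin 3) (Fin 3) ℂ) :
    (expAd x l B).conjTranspose = expAd x (conj l) B.conjTranspose := by
  simp only [expAd, Matrix.conjTranspose_mul, conjTranspose_expSig, map_neg, neg_neg,
    Matrix.mul_assoc]

lemma expAd_mul (x : ℝ) (l : ℂ) (A B : Matrix (Fin 3) (Fin 3) ℂ) :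
    expAd x l (A * B) = expAd x l A * expAd x l B := by
  have expSig_neg_mul : expSig x (-l) * expSig x l = 1 := by
    simpa only [neg_neg] using expSig_mul_expSig_neg x (-l)
  calc expSig x l * (A * B) * expSig x (-l)
      = expSig x l * A * 1 * (B * expSig x (-l)) := by simp only [Matrix.mul_assoc, Matrix.one_mul]
    _ = expAd x l A * expAd x l B := by
        simp only [← expSig_neg_mul, expAd, Matrix.mul_assoc]

lemma expAd_one_add_lowerBlock (x : ℝ) (l : ℂ) (c : Fin 2 → ℂ) :
    expAd x l (1 + lowerBlock c) = 1 + lowerBlock (exp (2 * I * x * l) • c) := by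
  have expAd_one : expAd x l 1 = 1 := by rw [expAd, Matrix.mul_one, expSig_mul_expSig_neg]
  have exp_mul : exp (I * l * x) * exp (I * l * x) = exp (2 * I * x * l) := by
    rw [← Complex.exp_add]
    ring_nf
  have expAd_lowerBlock : expAd x l (lowerBlock c) = lowerBlock (exp (2 * I * x * l) • c) := by
    ext i j
    fin_cases i <;> fin_cases j <;>
      simp [expAd, expSig, lowerBlock, sig, Matrix.diagonal_mul, Matrix.mul_diagonal,
        mul_right_comm, exp_mul]
  calc expAd x l (1 + lowerBlock c) = expAd x l 1 + expAd x l (lowerBlock c) := by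
        simp only [expAd, mul_add, add_mul]
    _ = 1 + lowerBlock (exp (2 * I * x * l) • c) := by rw [expAd_one, expAd_lowerBlock]

end JumpMatrices

section RealLine

lemma conj_one_apply {m : Type*} [DecidableEq m] (i j : m) :
    conj ((1 : Matrix m m ℂ) i j) = (1 : Matrix m m ℂ) i j := by
  rw [Matrix.one_apply, apply_ite conj, map_one, map_zero]

/-- `A` is a matrix function on the closed upper half-plane with the regularity and the decay to the
identity that the Marchenko equation provides. -/
def IsNormalized {m : Type*} [DecidableEq m] (A : ℂ → Matrix m m ℂ) : Prop :=
  ∀ i j, IsDecaying fun w => A w i j - (1 : Matrix m m ℂ) i j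

lemma tendsto_neg_conj_cobounded : Tendsto (fun w : ℂ => -conj w) (cobounded ℂ) (cobounded ℂ) := by
  rw [← tendsto_norm_atTop_iff_cobounded]
  simpa only [norm_neg, Complex.norm_conj] using tendsto_norm_cobounded_atTop (E := ℂ)

lemma IsDecaying.conj_neg_conj {f : ℂ → ℂ} (hf : IsDecaying f) :
    IsDecaying fun w => conj (f (-conj w)) := by
  have tendsto_reflect {c : ℝ → Prop} : Tendsto (fun w : ℂ => -conj w)
      (cobounded ℂ ⊓ 𝓟 {w | c w.im}) (cobounded ℂ ⊓ 𝓟 {w | c w.im}) :=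
    tendsto_neg_conj_cobounded.inf (tendsto_principal_principal.2 fun w hw => by
      simpa only [mem_ofPred_eq, neg_im, conj_im, neg_neg] using hw)
  refine ⟨?_, fun w hw => ?_, ?_, fun δ hδ => ?_⟩
  · refine continuous_conj.comp_continuousOn (hf.continuousOn.comp
      continuous_conj.neg.continuousOn fun w hw => ?_)
    simpa only [mem_ofPred_eq, neg_im, conj_im, neg_neg] using hw
  · have hw' : 0 < (-conj w).im := by
      simpa only [mem_ofPred_eq, neg_im, conj_im, neg_neg] using hw
    have diff_at : DifferentiableAt ℂ (fun v => f (-v)) (conj w) :=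
      (hf.differentiableOn.differentiableAt
        ((isOpen_lt continuous_const continuous_im).mem_nhds hw')).comp _ differentiableAt_id.neg
    simpa only [conj_conj, Function.comp_def] using! diff_at.conj_conj.differentiableWithinAt
  · simpa only [map_zero, Function.comp_def] using
      (continuous_conj.tendsto 0).comp (hf.tendsto_zero.comp (tendsto_reflect (c := (0 ≤ ·))))
  · have isBigO_reflect := (hf.isBigO δ hδ).comp_tendsto (tendsto_reflect (c := (δ ≤ ·)))
    rw [← isBigO_norm_norm] at isBigO_reflect ⊢
    simpa only [Function.comp_def, Complex.norm_conj, norm_inv, norm_neg] using isBigO_reflect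

/-- The lower half-plane is parametrised by complex conjugation, which turns a solution there into a
function on the upper half-plane again. -/
theorem exists_real_line {ρ : Fin 2 → ℝ → ℂ} (hρ : ∀ k, IsRegular (ρ k)) :
    ∃ A B : ℂ → Matrix (Fin 3) (Fin 3) ℂ, IsNormalized A ∧ IsNormalized B ∧
      ∀ t : ℝ, A t = (B t).map conj * jumpReal (ρ 0 t) (ρ 1 t) := by
  choose p₀ m₀ p m hp₀ hm₀ hp hm jump using fun i : Fin 3 =>
    exists_row hρ ((1 : Matrix (Fin 3) (Fin 3) ℂ) i 0)
      ![(1 : Matrix (Fin 3) (Fin 3) ℂ) i 1, (1 : Matrix (Fin 3) (Fin 3) ℂ) i 2]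
  let A (w : ℂ) : Matrix (Fin 3) (Fin 3) ℂ :=
    1 + Matrix.of fun i => ![p₀ i w, p i 0 w, p i 1 w]
  let B (w : ℂ) : Matrix (Fin 3) (Fin 3) ℂ :=
    1 + Matrix.of fun i =>
      ![conj (m₀ i (-conj w)), conj (m i 0 (-conj w)), conj (m i 1 (-conj w))]
  refine ⟨A, B, fun i j => ?_, fun i j => ?_, fun t => ?_⟩
  · simp only [A, Matrix.add_apply, Matrix.of_apply, add_sub_cancel_left]
    fin_cases j
    exacts [hp₀ i, hp i 0, hp i 1]
  · simp only [B, Matrix.add_apply, Matrix.of_apply, add_sub_cancel_left]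
    fin_cases j
    exacts [(hm₀ i).conj_neg_conj, (hm i 0).conj_neg_conj, (hm i 1).conj_neg_conj]
  have factored : A t * (1 + lowerBlock (-fun k => ρ k t)) =
      (B t).map conj * (1 + lowerBlock fun k => ρ k t).conjTranspose := by
    ext i j
    obtain ⟨jump_succ, jump_zero⟩ := jump i t
    simp only [Fin.forall_fin_two, Fin.sum_univ_two, Matrix.cons_val_zero, Matrix.cons_val_one]
      at jump_succ jump_zero
    fin_cases j <;>
      simp only [A, B, lowerBlock, LinearMap.coe_mk, AddHom.coe_mk, Pi.neg_apply, Fin.zero_eta,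
        Fin.mk_one, Fin.reduceFinMk, Fin.reduceEq, Fin.isValue, Matrix.mul_apply,
        Fin.sum_univ_three, Matrix.add_apply, Matrix.map_apply, Matrix.conjTranspose_apply,
        Matrix.of_apply, Matrix.cons_val, Matrix.one_apply_eq, Matrix.one_apply_ne, ne_eq,
        not_false_eq_true, conj_one_apply, map_add, map_zero, conj_conj, conj_ofReal,
        RCLike.star_def]
    · linear_combination jump_zero
    · linear_combination jump_succ.1
    · linear_combination jump_succ.2
  calc A t = A t * ((1 + lowerBlock (-fun k => ρ k t)) * (1 + lowerBlock fun k => ρ k t)) := by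
        rw [one_add_lowerBlock_mul, neg_add_cancel, map_zero, add_zero, Matrix.mul_one]
    _ = (B t).map conj * jumpReal (ρ 0 t) (ρ 1 t) := by
        rw [← Matrix.mul_assoc, factored, Matrix.mul_assoc, ← jumpReal_eq]

end RealLine

section Poles

variable {x : ℝ} {w v : ℂ}

/-- The scalar function which has the residue `e^{2ixw}` at `w` and decays at infinity; the pole at
`conj w` makes it square integrable with weight on the real line. -/
noncomputable def outerPole (x : ℝ) (w v : ℂ) : ℂ :=
  exp (2 * I * x * w) * ((v - w)⁻¹ - (v - conj w)⁻¹)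

/-- The function `outerPole x w v - e^{2ixv} / (v - w)`, continued analytically to `v = w`. -/
noncomputable def innerPole (x : ℝ) (w v : ℂ) : ℂ :=
  -(exp (2 * I * x * w) * (v - conj w)⁻¹) - dslope (fun u => exp (2 * I * x * u)) w v

open Classical in
/-- The scalar factor that removes the circle of radius `s` around `w` from the contour. -/
noncomputable def dressPole (x : ℝ) (w : ℂ) (s : ℝ) (v : ℂ) : ℂ :=
  if dist v w < s then innerPole x w v else outerPole x w v

lemma innerPole_of_ne (h : v ≠ w) :
    innerPole x w v = outerPole x w v - exp (2 * I * x * v) / (v - w) := by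
  have sub_ne : v - w ≠ 0 := sub_ne_zero.2 h
  rw [outerPole, innerPole, dslope_of_ne _ h, slope_def_field]
  field_simp
  ring

lemma differentiableAt_outerPole (h : v ≠ w) (h' : v ≠ conj w) :
    DifferentiableAt ℂ (outerPole x w) v := by
  unfold outerPole
  fun_prop (disch := exact sub_ne_zero.2 ‹_›)

lemma differentiableAt_innerPole (h : v ≠ conj w) : DifferentiableAt ℂ (innerPole x w) v := by
  have differentiable_dslope : Differentiable ℂ (dslope (fun u : ℂ => exp (2 * I * x * u)) w) := by
    rw [← differentiableOn_univ, differentiableOn_dslope univ_mem]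
    fun_prop
  unfold innerPole
  fun_prop (disch := exact sub_ne_zero.2 ‹_›)

lemma isBigO_inv_sub_const (a : ℂ) : (fun v : ℂ => (v - a)⁻¹) =O[cobounded ℂ] fun v => v⁻¹ := by
  have sub_isEquivalent : (fun v : ℂ => v - a) ~[cobounded ℂ] id :=
    IsEquivalent.refl.sub_isLittleO (isLittleO_const_id_cobounded a)
  exact sub_isEquivalent.inv.isBigO

lemma isBigO_outerPole : outerPole x w =O[cobounded ℂ] fun v => v⁻¹ :=
  ((isBigO_inv_sub_const w).sub (isBigO_inv_sub_const (conj w))).const_mul_left _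

lemma dressPole_of_mem_ball {s : ℝ} (h : v ∈ Metric.ball w s) :
    dressPole x w s v = innerPole x w v := if_pos h

lemma dressPole_of_le_dist {s : ℝ} (h : s ≤ dist v w) :
    dressPole x w s v = outerPole x w v := if_neg (not_lt.2 h)

lemma dressPole_eventuallyEq_innerPole {s : ℝ} (h : v ∈ Metric.ball w s) :
    dressPole x w s =ᶠ[𝓝 v] innerPole x w := by
  filter_upwards [Metric.isOpen_ball.mem_nhds h] with u hu
  exact dressPole_of_mem_ball hu

lemma dressPole_eventuallyEq_outerPole {s : ℝ} (h : s < dist v w) :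
    dressPole x w s =ᶠ[𝓝 v] outerPole x w := by
  filter_upwards [(isOpen_lt continuous_const (continuous_id.dist continuous_const)).mem_nhds h]
    with u hu
  exact dressPole_of_le_dist hu.le

lemma isBigO_dressPole {s : ℝ} : dressPole x w s =O[cobounded ℂ] fun v => v⁻¹ := by
  refine (isBigO_outerPole (x := x) (w := w)).congr' ?_ .rfl
  filter_upwards [(Metric.tendsto_dist_right_cobounded_atTop w).eventually_ge_atTop s] with v hv
  exact (dressPole_of_le_dist hv).symm

lemma ne_conj_of_im_pos (hw : 0 < w.im) (hv : 0 ≤ v.im) : v ≠ conj w := by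
  rintro rfl
  rw [conj_im] at hv
  linarith

lemma differentiableAt_dressPole {s : ℝ} (hs : 0 < s) (hw : 0 < w.im) (hv : 0 ≤ v.im)
    (hvs : dist v w ≠ s) : DifferentiableAt ℂ (dressPole x w s) v := by
  have ne_conj : v ≠ conj w := ne_conj_of_im_pos hw hv
  rcases lt_or_gt_of_ne hvs with inside | outside
  · exact (differentiableAt_innerPole ne_conj).congr_of_eventuallyEq
      (dressPole_eventuallyEq_innerPole inside)
  · exact (differentiableAt_outerPole (dist_pos.1 (hs.trans outside)) ne_conj).congr_of_eventuallyEq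
      (dressPole_eventuallyEq_outerPole outside)

lemma tendsto_dressPole_outer {s : ℝ} {F : Filter ℂ} (hF : F ≤ 𝓝 v) (hv : v ≠ w)
    (hv' : v ≠ conj w) (h : ∀ᶠ u in F, s ≤ dist u w) :
    Tendsto (dressPole x w s) F (𝓝 (outerPole x w v)) :=
  ((differentiableAt_outerPole hv hv').continuousAt.mono_left hF).congr'
    (h.mono fun _ hu => (dressPole_of_le_dist hu).symm)

lemma tendsto_dressPole_inner {s : ℝ} {F : Filter ℂ} (hF : F ≤ 𝓝 v) (hv : v ≠ conj w)
    (h : ∀ᶠ u in F, u ∈ Metric.ball w s) :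
    Tendsto (dressPole x w s) F (𝓝 (innerPole x w v)) :=
  ((differentiableAt_innerPole hv).continuousAt.mono_left hF).congr'
    (h.mono fun _ hu => (dressPole_of_mem_ball hu).symm)

end Poles

section BoundaryApproach

variable {n : ℕ} {z : Fin n → ℂ} {r : Fin n → ℝ} {l : ℂ} {x : ℝ}

lemma minusSide_subset_compl_contour (hsep : IsSeparated z r) :
    minusSide z r ⊆ (contour z r)ᶜ := fun w hw => by
  rw [mem_compl_iff, ← conj_mem_contour]
  exact plusSide_subset_compl_contour hsep (conj_mem_plusSide.2 hw)

lemma radius_le_dist_of_mem_contour (hsep : IsSeparated z r) (hl : l ∈ contour z r) (i : Fin n) :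
    r i ≤ dist l (z i) := by
  by_contra! hlt
  exact minusSide_subset_compl_contour hsep (mem_minusSide.2 (Or.inr ⟨i, hlt⟩)) hl

lemma eventually_nhdsWithin_plusSide (hsep : IsSeparated z r) (hl : 0 ≤ l.im) :
    ∀ᶠ v in 𝓝[plusSide z r] l, 0 < v.im ∧ ∀ i, r i < dist v (z i) := by
  have notMem_closedBall : ∀ᶠ v in 𝓝 l, ∀ i, v ∉ Metric.closedBall (conj (z i)) (r i) :=
    eventually_all.2 fun i => Metric.isClosed_closedBall.isOpen_compl.mem_nhds fun h =>
      (im_neg_of_dist_conj_le (hsep.radius_lt_im i) h).not_ge hl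
  filter_upwards [self_mem_nhdsWithin, mem_nhdsWithin_of_mem_nhds notMem_closedBall] with v hv hv'
  exact (mem_plusSide.1 hv).resolve_right fun ⟨i, hi⟩ => hv' i (Metric.ball_subset_closedBall hi)

lemma eventually_nhdsWithin_minusSide (hsep : IsSeparated z r) {i : Fin n}
    (hl : l ∈ Metric.sphere (z i) (r i)) :
    ∀ᶠ v in 𝓝[minusSide z r] l, 0 < v.im ∧ v ∈ Metric.ball (z i) (r i) ∧
      ∀ j ≠ i, r j < dist v (z j) := by
  have im_pos : ∀ᶠ v in 𝓝 l, 0 < v.im :=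
    (isOpen_lt continuous_const continuous_im).mem_nhds
      (im_pos_of_dist_le (hsep.radius_lt_im i) (Metric.mem_sphere.1 hl).le)
  have outside_others : ∀ᶠ v in 𝓝 l, ∀ j ≠ i, r j < dist v (z j) :=
    eventually_all.2 fun j => eventually_imp_distrib_left.2 fun hj =>
      (isOpen_lt continuous_const (continuous_id.dist continuous_const)).mem_nhds
        (lt_dist_of_dist_le (hsep.radius_add_lt_dist i j hj.symm) (Metric.mem_sphere.1 hl).le)
  filter_upwards [self_mem_nhdsWithin, mem_nhdsWithin_of_mem_nhds im_pos,
    mem_nhdsWithin_of_mem_nhds outside_others] with v hv v_im v_out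
  obtain ⟨j, hj⟩ := (mem_minusSide.1 hv).resolve_left fun h => h.1.not_gt v_im
  by_cases hji : j = i
  · exact ⟨v_im, hji ▸ hj, v_out⟩
  · exact absurd hj (v_out j hji).not_gt

lemma eventually_im_pos_plusSide (hsep : IsSeparated z r) (hl : 0 ≤ l.im) :
    ∀ᶠ v in 𝓝[plusSide z r] l, 0 < v.im :=
  (eventually_nhdsWithin_plusSide hsep hl).mono fun _ hv => hv.1

lemma eventually_im_pos_minusSide (hsep : IsSeparated z r) {i : Fin n}
    (hl : l ∈ Metric.sphere (z i) (r i)) : ∀ᶠ v in 𝓝[minusSide z r] l, 0 < v.im :=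
  (eventually_nhdsWithin_minusSide hsep hl).mono fun _ hv => hv.1

lemma tendsto_conj_nhdsWithin_plusSide :
    Tendsto conj (𝓝[plusSide z r] l) (𝓝[minusSide z r] (conj l)) :=
  continuous_conj.continuousWithinAt.tendsto_nhdsWithin fun v hv =>
    conj_mem_plusSide.1 (by rwa [conj_conj])

lemma tendsto_conj_nhdsWithin_minusSide :
    Tendsto conj (𝓝[minusSide z r] l) (𝓝[plusSide z r] (conj l)) :=
  continuous_conj.continuousWithinAt.tendsto_nhdsWithin fun _ => conj_mem_plusSide.2

/-- The values at `v` of the functions `outerPole` for all the poles. -/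
noncomputable def outerVector (x : ℝ) (z : Fin n → ℂ) (v : ℂ) : Fin n → ℂ :=
  fun i => outerPole x (z i) v

/-- The values at `v` of the functions `dressPole` for all the circles. -/
noncomputable def dressVector (x : ℝ) (z : Fin n → ℂ) (r : Fin n → ℝ) (v : ℂ) : Fin n → ℂ :=
  fun i => dressPole x (z i) (r i) v

lemma differentiableAt_dressVector (hsep : IsSeparated z r) {v : ℂ} (hv : 0 < v.im)
    (hvr : ∀ i, dist v (z i) ≠ r i) : DifferentiableAt ℂ (dressVector x z r) v :=
  differentiableAt_pi.2 fun i => differentiableAt_dressPole (hsep.radius_pos i)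
    ((hsep.radius_pos i).trans (hsep.radius_lt_im i)) hv.le (hvr i)

lemma isBigO_dressVector : dressVector x z r =O[cobounded ℂ] fun v => v⁻¹ :=
  isBigO_pi.2 fun _ => isBigO_dressPole

lemma tendsto_dressPole_outerPole (hsep : IsSeparated z r) (hl : l ∈ contour z r)
    (hl' : 0 ≤ l.im) {i : Fin n} {F : Filter ℂ} (hF : F ≤ 𝓝 l)
    (h : ∀ᶠ v in F, r i < dist v (z i)) :
    Tendsto (dressPole x (z i) (r i)) F (𝓝 (outerPole x (z i) l)) :=
  tendsto_dressPole_outer hF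
    (dist_pos.1 ((hsep.radius_pos i).trans_le (radius_le_dist_of_mem_contour hsep hl i)))
    (ne_conj_of_im_pos ((hsep.radius_pos i).trans (hsep.radius_lt_im i)) hl')
    (h.mono fun _ => le_of_lt)

lemma tendsto_dressVector_plusSide (hsep : IsSeparated z r) (hl : l ∈ contour z r)
    (hl' : 0 ≤ l.im) :
    Tendsto (dressVector x z r) (𝓝[plusSide z r] l) (𝓝 (outerVector x z l)) :=
  tendsto_pi_nhds.2 fun i => tendsto_dressPole_outerPole hsep hl hl' nhdsWithin_le_nhds
    ((eventually_nhdsWithin_plusSide hsep hl').mono fun _ hv => hv.2 i)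

lemma tendsto_dressVector_minusSide (hsep : IsSeparated z r) {i : Fin n}
    (hl : l ∈ Metric.sphere (z i) (r i)) :
    Tendsto (dressVector x z r) (𝓝[minusSide z r] l)
      (𝓝 (outerVector x z l - Pi.single i (exp (2 * I * x * l) / (l - z i)))) := by
  have l_mem : l ∈ contour z r := mem_contour.2 (Or.inr (Or.inl ⟨i, hl⟩))
  have l_im : 0 < l.im := im_pos_of_dist_le (hsep.radius_lt_im i) (Metric.mem_sphere.1 hl).le
  refine tendsto_pi_nhds.2 fun j => ?_
  by_cases hj : j = i
  · subst hj
    have l_ne : l ≠ z j := Metric.ne_of_mem_sphere hl (hsep.radius_pos j).ne'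
    rw [Pi.sub_apply, Pi.single_eq_same, outerVector, ← innerPole_of_ne l_ne]
    exact tendsto_dressPole_inner nhdsWithin_le_nhds
      (ne_conj_of_im_pos ((hsep.radius_pos j).trans (hsep.radius_lt_im j)) l_im.le)
      ((eventually_nhdsWithin_minusSide hsep hl).mono fun _ hv => hv.2.1)
  · rw [Pi.sub_apply, Pi.single_eq_of_ne hj, sub_zero]
    exact tendsto_dressPole_outerPole hsep l_mem l_im.le nhdsWithin_le_nhds
      ((eventually_nhdsWithin_minusSide hsep hl).mono fun _ hv => hv.2.2 j hj)

end BoundaryApproach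

section Dressing

variable {n : ℕ} {z : Fin n → ℂ} {r : Fin n → ℝ} {l : ℂ} {x : ℝ} {m : Type*}
  [DecidableEq m] {A : ℂ → Matrix m m ℂ} {L : (Fin n → ℂ) →ₗ[ℂ] Matrix m m ℂ}

lemma IsNormalized.continuousOn (hA : IsNormalized A) : ContinuousOn A {w | 0 ≤ w.im} :=
  continuousOn_pi.2 fun i => continuousOn_pi.2 fun j => by
    simpa only [sub_add_cancel, Pi.add_def] using
      (hA i j).continuousOn.add (continuousOn_const (c := (1 : Matrix m m ℂ) i j))

lemma IsNormalized.differentiableAt (hA : IsNormalized A) {v : ℂ} (hv : 0 < v.im) (i j : m) :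
    DifferentiableAt ℂ (fun w => A w i j) v := by
  simpa only [sub_add_cancel] using ((hA i j).differentiableOn.differentiableAt
    ((isOpen_lt continuous_const continuous_im).mem_nhds hv)).add_const ((1 : Matrix m m ℂ) i j)

lemma IsNormalized.tendsto_one (hA : IsNormalized A) :
    Tendsto A (cobounded ℂ ⊓ 𝓟 {w | 0 ≤ w.im}) (𝓝 1) :=
  tendsto_pi_nhds.2 fun i => tendsto_pi_nhds.2 fun j =>
    tendsto_sub_nhds_zero_iff.1 (hA i j).tendsto_zero

/-- The properties of a solution in the open upper half-plane, where the contour consists of the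
circles `γ_i`. -/
structure IsNormalizedOffCircles (z : Fin n → ℂ) (r : Fin n → ℝ) (P : ℂ → Matrix m m ℂ) :
    Prop where
  differentiableAt : ∀ v : ℂ, 0 < v.im → (∀ i, dist v (z i) ≠ r i) →
    ∀ i j, DifferentiableAt ℂ (fun w => P w i j) v
  tendsto_one : Tendsto P (cobounded ℂ ⊓ 𝓟 {w | 0 < w.im}) (𝓝 1)
  isBigO : ∀ δ : ℝ, 0 < δ → ∀ i j,
    (fun w => P w i j - (1 : Matrix m m ℂ) i j) =O[cobounded ℂ ⊓ 𝓟 {w | δ ≤ w.im}] fun w => w⁻¹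

variable [Fintype m]

/-- The dressing of `A` by a unipotent factor, which creates jumps on the circles. -/
noncomputable def dressed (x : ℝ) (z : Fin n → ℂ) (r : Fin n → ℝ) (A : ℂ → Matrix m m ℂ)
    (L : (Fin n → ℂ) →ₗ[ℂ] Matrix m m ℂ) (v : ℂ) : Matrix m m ℂ :=
  A v * (1 + L (dressVector x z r v))

lemma tendsto_dressed {F : Filter ℂ} {a : Matrix m m ℂ} {p : Fin n → ℂ} (hA : Tendsto A F (𝓝 a))
    (hp : Tendsto (dressVector x z r) F (𝓝 p)) :
    Tendsto (dressed x z r A L) F (𝓝 (a * (1 + L p))) :=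
  hA.mul (tendsto_const_nhds.add ((L.continuous_on_pi.tendsto p).comp hp))

lemma IsNormalized.tendsto_dressed_nhdsWithin (hA : IsNormalized A) {s : Set ℂ} {p : Fin n → ℂ}
    (hl : 0 ≤ l.im) (hs : ∀ᶠ v in 𝓝[s] l, 0 < v.im)
    (hp : Tendsto (dressVector x z r) (𝓝[s] l) (𝓝 p)) :
    Tendsto (dressed x z r A L) (𝓝[s] l) (𝓝 (A l * (1 + L p))) :=
  tendsto_dressed ((hA.continuousOn l hl).mono_left
    (le_inf nhdsWithin_le_nhds (le_principal_iff.2 (hs.mono fun _ => le_of_lt)))) hp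

lemma IsNormalized.tendsto_dressed_plusSide (hsep : IsSeparated z r) (hA : IsNormalized A)
    (hl : l ∈ contour z r) (hl' : 0 ≤ l.im) :
    Tendsto (dressed x z r A L) (𝓝[plusSide z r] l) (𝓝 (A l * (1 + L (outerVector x z l)))) :=
  hA.tendsto_dressed_nhdsWithin hl' (eventually_im_pos_plusSide hsep hl')
    (tendsto_dressVector_plusSide hsep hl hl')

lemma IsNormalized.tendsto_dressed_minusSide (hsep : IsSeparated z r) (hA : IsNormalized A)
    {i : Fin n} (hl : l ∈ Metric.sphere (z i) (r i)) :
    Tendsto (dressed x z r A L) (𝓝[minusSide z r] l)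
      (𝓝 (A l * (1 + L (outerVector x z l - Pi.single i (exp (2 * I * x * l) / (l - z i)))))) :=
  hA.tendsto_dressed_nhdsWithin (im_pos_of_dist_le (hsep.radius_lt_im i) hl.le).le
    (eventually_im_pos_minusSide hsep hl) (tendsto_dressVector_minusSide hsep hl)

lemma IsNormalized.isNormalizedOffCircles_dressed (hsep : IsSeparated z r) (hA : IsNormalized A) :
    IsNormalizedOffCircles z r (dressed x z r A L) := by
  let entry (i j : m) : (Fin n → ℂ) →L[ℂ] ℂ :=
    (Matrix.entryLinearMap ℂ ℂ i j ∘ₗ L).toContinuousLinearMap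
  have dressed_apply (v : ℂ) (i j : m) : dressed x z r A L v i j =
      A v i j + ∑ k, A v i k * entry k j (dressVector x z r v) := by
    rw [dressed, mul_add, Matrix.mul_one, Matrix.add_apply, Matrix.mul_apply]
    rfl
  refine ⟨fun v hv hvr i j => ?_, ?_, fun δ hδ i j => ?_⟩
  · simp only [dressed_apply]
    exact (hA.differentiableAt hv i j).add (DifferentiableAt.fun_sum fun k _ =>
      (hA.differentiableAt hv i k).mul
        ((entry k j).differentiableAt.comp v (differentiableAt_dressVector hsep hv hvr)))
  · have upper_subset : {w : ℂ | 0 < w.im} ⊆ {w | 0 ≤ w.im} := fun w (hw : 0 < w.im) => hw.le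
    have tendsto_zero : Tendsto (dressVector x z r) (cobounded ℂ) (𝓝 0) :=
      isBigO_dressVector.trans_tendsto tendsto_inv₀_cobounded
    simpa only [map_zero, add_zero, mul_one] using tendsto_dressed
      (hA.tendsto_one.mono_left (inf_le_inf_left _ (principal_mono.2 upper_subset)))
      (tendsto_zero.mono_left inf_le_left)
  · have A_bounded (k : m) :
        (fun v => A v i k) =O[cobounded ℂ ⊓ 𝓟 {w | δ ≤ w.im}] fun _ => (1 : ℂ) :=
      ((tendsto_pi_nhds.1 (tendsto_pi_nhds.1 hA.tendsto_one i) k).mono_left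
        (inf_le_inf_left _ (principal_mono.2 fun _ hw => hδ.le.trans hw))).isBigO_one ℂ
    simp only [dressed_apply, add_sub_right_comm]
    refine ((hA i j).isBigO δ hδ).add (IsBigO.fun_sum fun k _ => ?_)
    simpa only [one_mul] using (A_bounded k).mul
      (((entry k j).isBigO_comp _ _).trans (isBigO_dressVector.mono inf_le_left))

end Dressing

section Gluing

variable {m : Type*} {P Q : ℂ → Matrix m m ℂ} {F : Filter ℂ} {a : Matrix m m ℂ}

open Classical in
/-- The function equal to `P` in the upper half-plane, and to the reflection of `Q` by complex
conjugation elsewhere. -/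
noncomputable def conjGlue (P Q : ℂ → Matrix m m ℂ) (v : ℂ) : Matrix m m ℂ :=
  if 0 < v.im then P v else (Q (conj v)).map conj

lemma conjGlue_of_im_pos {v : ℂ} (hv : 0 < v.im) : conjGlue P Q v = P v := if_pos hv

lemma conjGlue_of_im_neg {v : ℂ} (hv : v.im < 0) : conjGlue P Q v = (Q (conj v)).map conj :=
  if_neg hv.not_gt

lemma tendsto_conjGlue_of_im_pos (hF : ∀ᶠ v in F, 0 < v.im) (hP : Tendsto P F (𝓝 a)) :
    Tendsto (conjGlue P Q) F (𝓝 a) :=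
  hP.congr' (hF.mono fun _ hv => (conjGlue_of_im_pos hv).symm)

lemma tendsto_conjGlue_of_im_neg {G : Filter ℂ} (hG : ∀ᶠ v in G, 0 < v.im)
    (hF : Tendsto conj F G) (hQ : Tendsto Q G (𝓝 a)) :
    Tendsto (conjGlue P Q) F (𝓝 (a.map conj)) := by
  have map_conj_continuous : Continuous fun b : Matrix m m ℂ => b.map conj :=
    continuous_id.matrix_map continuous_conj
  refine ((map_conj_continuous.tendsto a).comp (hQ.comp hF)).congr' ?_
  filter_upwards [hF.eventually hG] with v hv
  exact (conjGlue_of_im_neg (by simpa using hv)).symm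

variable {n : ℕ} {z : Fin n → ℂ} {r : Fin n → ℝ} [DecidableEq m]

lemma tendsto_conj_cobounded_inf_principal {c : ℝ → Prop} :
    Tendsto conj (cobounded ℂ ⊓ 𝓟 {w | c (-w.im)}) (cobounded ℂ ⊓ 𝓟 {w | c w.im}) := by
  refine Tendsto.inf ?_ (tendsto_principal_principal.2 fun w hw => by simpa using hw)
  rw [← tendsto_norm_atTop_iff_cobounded]
  simpa only [Complex.norm_conj] using tendsto_norm_cobounded_atTop (E := ℂ)

lemma differentiableOn_conjGlue (hP : IsNormalizedOffCircles z r P)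
    (hQ : IsNormalizedOffCircles z r Q) (i j : m) :
    DifferentiableOn ℂ (fun w => conjGlue P Q w i j) (contour z r)ᶜ := by
  intro v hv
  rw [mem_compl_iff, mem_contour] at hv
  push Not at hv
  obtain ⟨im_ne, dist_ne, dist_conj_ne⟩ := hv
  refine DifferentiableAt.differentiableWithinAt ?_
  rcases lt_or_gt_of_ne im_ne with im_neg | im_pos
  · have diff_conj : DifferentiableAt ℂ (fun w => Q w i j) (conj v) :=
      hQ.differentiableAt _ (by simpa using im_neg)
        (fun k => by simpa only [dist_conj_left] using dist_conj_ne k) i j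
    have diff_reflect := diff_conj.conj_conj
    rw [conj_conj] at diff_reflect
    refine diff_reflect.congr_of_eventuallyEq ?_
    filter_upwards [(isOpen_lt continuous_im continuous_const).mem_nhds im_neg] with w hw
    exact congrFun (congrFun (conjGlue_of_im_neg hw) i) j
  · refine (hP.differentiableAt v im_pos dist_ne i j).congr_of_eventuallyEq ?_
    filter_upwards [(isOpen_lt continuous_const continuous_im).mem_nhds im_pos] with w hw
    exact congrFun (congrFun (conjGlue_of_im_pos hw) i) j

lemma tendsto_conjGlue_cobounded (hP : IsNormalizedOffCircles z r P)
    (hQ : IsNormalizedOffCircles z r Q) :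
    Tendsto (conjGlue P Q) (cobounded ℂ ⊓ 𝓟 (contour z r)ᶜ) (𝓝 1) := by
  have tendsto_upper : Tendsto (conjGlue P Q) (cobounded ℂ ⊓ 𝓟 {w | 0 < w.im}) (𝓝 1) :=
    tendsto_conjGlue_of_im_pos (mem_inf_of_right (mem_principal_self _)) hP.tendsto_one
  have tendsto_lower : Tendsto (conjGlue P Q) (cobounded ℂ ⊓ 𝓟 {w | 0 < -w.im}) (𝓝 1) := by
    simpa only [Matrix.map_one conj (map_zero _) (map_one _)] using
      tendsto_conjGlue_of_im_neg (P := P) (mem_inf_of_right (mem_principal_self _))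
        (tendsto_conj_cobounded_inf_principal (c := (0 < ·))) hQ.tendsto_one
  refine (tendsto_upper.sup tendsto_lower).mono_left ?_
  rw [← inf_sup_left, sup_principal]
  refine inf_le_inf_left _ (principal_mono.2 fun w hw => ?_)
  have im_ne : w.im ≠ 0 := fun h => hw (mem_contour.2 (Or.inl h))
  exact im_ne.lt_or_gt.symm.imp_right neg_pos.2

lemma isBigO_conjGlue (hP : IsNormalizedOffCircles z r P) (hQ : IsNormalizedOffCircles z r Q)
    {δ : ℝ} (hδ : 0 < δ) (i j : m) :
    (fun w => conjGlue P Q w i j - (1 : Matrix m m ℂ) i j)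
      =O[cobounded ℂ ⊓ 𝓟 {w | δ ≤ |w.im|}] fun w => w⁻¹ := by
  have upper : (fun w => conjGlue P Q w i j - (1 : Matrix m m ℂ) i j)
      =O[cobounded ℂ ⊓ 𝓟 {w | δ ≤ w.im}] fun w => w⁻¹ := by
    refine (hP.isBigO δ hδ i j).congr' ?_ .rfl
    filter_upwards [mem_inf_of_right (mem_principal_self _)] with w hw
    rw [conjGlue_of_im_pos (hδ.trans_le hw)]
  have lower : (fun w => conjGlue P Q w i j - (1 : Matrix m m ℂ) i j)
      =O[cobounded ℂ ⊓ 𝓟 {w | δ ≤ -w.im}] fun w => w⁻¹ := by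
    have isBigO_conj := (hQ.isBigO δ hδ i j).comp_tendsto
      (tendsto_conj_cobounded_inf_principal (c := (δ ≤ ·)))
    rw [← isBigO_norm_norm] at isBigO_conj ⊢
    refine isBigO_conj.congr' ?_ (.of_eq (funext fun w => by simp))
    filter_upwards [mem_inf_of_right (mem_principal_self _)] with w hw
    rw [conjGlue_of_im_neg (neg_pos.1 (hδ.trans_le hw)), Function.comp_apply, ← Complex.norm_conj,
      map_sub, conj_one_apply, Matrix.map_apply]
  have split : cobounded ℂ ⊓ 𝓟 {w : ℂ | δ ≤ |w.im|} =
      cobounded ℂ ⊓ 𝓟 {w | δ ≤ w.im} ⊔ cobounded ℂ ⊓ 𝓟 {w | δ ≤ -w.im} := by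
    simp only [← inf_sup_left, sup_principal, le_abs, ofPred_or]
  rw [split]
  exact upper.sup lower

end Gluing

section Existence

variable {n : ℕ} {z : Fin n → ℂ} {r : Fin n → ℝ} {x : ℝ} {C : Fin n → Fin 2 → ℂ}

/-- The exponent of the dressing factor in the upper half-plane. -/
noncomputable def poleMap (C : Fin n → Fin 2 → ℂ) : (Fin n → ℂ) →ₗ[ℂ] Matrix (Fin 3) (Fin 3) ℂ :=
  lowerBlock ∘ₗ Fintype.linearCombination ℂ C

/-- The exponent of the dressing factor in the lower half-plane, in the coordinate `conj v`. Its
exponential is the inverse transpose of that of `poleMap`. -/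
noncomputable def dualPoleMap (C : Fin n → Fin 2 → ℂ) :
    (Fin n → ℂ) →ₗ[ℂ] Matrix (Fin 3) (Fin 3) ℂ :=
  -((Matrix.transposeLinearEquiv (Fin 3) (Fin 3) ℂ ℂ).toLinearMap ∘ₗ poleMap C)

lemma one_add_poleMap_mul (p q : Fin n → ℂ) :
    (1 + poleMap C p) * (1 + poleMap C q) = 1 + poleMap C (p + q) := by
  simp only [poleMap, LinearMap.comp_apply, one_add_lowerBlock_mul, map_add]

lemma one_add_dualPoleMap_map_conj (p : Fin n → ℂ) :
    (1 + dualPoleMap C p).map conj = (1 + poleMap C (-p)).conjTranspose := by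
  have dual_eq : 1 + dualPoleMap C p = (1 + poleMap C (-p)).transpose := by
    rw [Matrix.transpose_add, Matrix.transpose_one, map_neg, Matrix.transpose_neg]
    rfl
  rw [dual_eq]
  rfl

lemma expAd_jumpUp (i : Fin n) (l : ℂ) :
    expAd x l (jumpUp (z i) (C i) l) =
      1 + poleMap C (Pi.single i (exp (2 * I * x * l) / (l - z i))) := by
  rw [jumpUp_eq, expAd_one_add_lowerBlock, smul_smul, poleMap, LinearMap.comp_apply,
    Fintype.linearCombination_apply_single, div_eq_mul_inv]

lemma expAd_jumpDown (i : Fin n) (l : ℂ) :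
    expAd x l (jumpDown (z i) (C i) l) =
      (1 + poleMap C
        (Pi.single i (exp (2 * I * x * conj l) / (conj l - z i)))).conjTranspose := by
  rw [jumpDown_eq_conjTranspose, ← expAd_jumpUp, conjTranspose_expAd, conj_conj]

/-- The reflection coefficients of the problem on the real line that remains when the circles are
removed. -/
noncomputable def dressedReflection (x : ℝ) (z : Fin n → ℂ) (C : Fin n → Fin 2 → ℂ)
    (ρ : Fin 2 → ℝ → ℂ) (k : Fin 2) (t : ℝ) : ℂ :=
  exp (2 * I * x * t) * ρ k t - Fintype.linearCombination ℂ C (outerVector x z t) k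

lemma isRegular_dressedReflection {ρ : Fin 2 → ℝ → ℂ} (hρ : ∀ k, IsRegular (ρ k))
    (hz : ∀ i, (z i).im ≠ 0) (k : Fin 2) : IsRegular (dressedReflection x z C ρ k) := by
  have pole_sum := IsRegular.sum Finset.univ fun i _ =>
    (isRegular_inv_sub_inv_conj (hz i)).const_smul (-(exp (2 * I * x * z i) * C i k))
  have eq_add : dressedReflection x z C ρ k = (fun t : ℝ => exp (2 * I * x * t) * ρ k t) +
      ∑ i, (-(exp (2 * I * x * z i) * C i k)) •
        fun t : ℝ => ((t : ℂ) - z i)⁻¹ - ((t : ℂ) - conj (z i))⁻¹ := by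
    ext t
    simp only [dressedReflection, Fintype.linearCombination_apply, outerVector, outerPole,
      Pi.add_apply, Finset.sum_apply, Pi.smul_apply, smul_eq_mul, sub_eq_add_neg,
      ← Finset.sum_neg_distrib]
    congr 2 with i
    ring
  exact eq_add ▸ ((hρ k).modulate x).add pole_sum

lemma jumpReal_dressedReflection_mul (ρ : Fin 2 → ℝ → ℂ) (t : ℝ) :
    jumpReal (dressedReflection x z C ρ 0 t) (dressedReflection x z C ρ 1 t) *
        (1 + poleMap C (outerVector x z t)) =
      (1 + dualPoleMap C (outerVector x z t)).map conj *
        expAd x t (jumpReal (ρ 0 t) (ρ 1 t)) := by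
  let U := 1 + lowerBlock fun k => dressedReflection x z C ρ k t
  let W := 1 + lowerBlock fun k => exp (2 * I * x * t) * ρ k t
  let p := outerVector x z t
  have U_mul : U * (1 + poleMap C p) = W := by
    rw [poleMap, LinearMap.comp_apply, one_add_lowerBlock_mul]
    congr 2 with k
    exact sub_add_cancel _ _
  have W_mul : W * (1 + poleMap C (-p)) = U := by
    rw [← U_mul, Matrix.mul_assoc, one_add_poleMap_mul, add_neg_cancel, map_zero, add_zero,
      Matrix.mul_one]
  have expAd_jumpReal : expAd x t (jumpReal (ρ 0 t) (ρ 1 t)) = W.conjTranspose * W := by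
    rw [jumpReal_eq fun k => ρ k t, expAd_mul, ← conj_ofReal, ← conjTranspose_expAd, conj_ofReal,
      expAd_one_add_lowerBlock]
    rfl
  calc _ = U.conjTranspose * (U * (1 + poleMap C p)) := by
        rw [jumpReal_eq fun k => dressedReflection x z C ρ k t, Matrix.mul_assoc]
    _ = (1 + poleMap C (-p)).conjTranspose * (W.conjTranspose * W) := by
        rw [U_mul, ← Matrix.mul_assoc, ← Matrix.conjTranspose_mul, W_mul]
    _ = _ := by rw [one_add_dualPoleMap_map_conj, expAd_jumpReal]

lemma isSolution_of_isJump {ρ₁ ρ₂ : ℝ → ℂ} {M : ℂ → Matrix (Fin 3) (Fin 3) ℂ}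
    (hsep : IsSeparated z r)
    (analytic : ∀ i j, DifferentiableOn ℂ (fun w => M w i j) (contour z r)ᶜ)
    (tendsto_one : Tendsto M (cobounded ℂ ⊓ 𝓟 (contour z r)ᶜ) (𝓝 1))
    (isBigO : ∀ δ : ℝ, 0 < δ → ∀ i j,
      (fun w => M w i j - (1 : Matrix (Fin 3) (Fin 3) ℂ) i j)
        =O[cobounded ℂ ⊓ 𝓟 {w | δ ≤ |w.im|}] fun w => w⁻¹)
    (jump : ∀ l V, IsJump x ρ₁ ρ₂ z r C l V → ∃ a b, Tendsto M (𝓝[plusSide z r] l) (𝓝 a) ∧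
      Tendsto M (𝓝[minusSide z r] l) (𝓝 b) ∧ a = b * V) :
    IsSolution x ρ₁ ρ₂ z r C M := by
  have : RegularSpace (Matrix (Fin 3) (Fin 3) ℂ) :=
    inferInstanceAs (RegularSpace (Fin 3 → Fin 3 → ℂ))
  have limits : ∀ l ∈ contour z r, (∃ a, Tendsto M (𝓝[plusSide z r] l) (𝓝 a)) ∧
      ∃ b, Tendsto M (𝓝[minusSide z r] l) (𝓝 b) := fun l hl => by
    obtain ⟨V, hV⟩ := exists_isJump (x := x) (ρ₁ := ρ₁) (ρ₂ := ρ₂) (C := C) hl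
    obtain ⟨a, b, ha, hb, -⟩ := jump l V hV
    exact ⟨⟨a, ha⟩, b, hb⟩
  have jump_extend : ∀ l ∈ contour z r, ∀ V, IsJump x ρ₁ ρ₂ z r C l V →
      extendFrom (plusSide z r) M l = extendFrom (minusSide z r) M l * V := fun l hl V hV => by
    obtain ⟨a, b, ha, hb, hab⟩ := jump l V hV
    rw [extendFrom_eq (contour_subset_closure_plusSide hsep hl) ha,
      extendFrom_eq (contour_subset_closure_minusSide hsep hl) hb, hab]
  exact ⟨analytic, tendsto_one, isBigO, extendFrom (plusSide z r) M, extendFrom (minusSide z r) M,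
    continuousOn_extendFrom (contour_subset_closure_plusSide hsep) fun l hl => (limits l hl).1,
    continuousOn_extendFrom (contour_subset_closure_minusSide hsep) fun l hl => (limits l hl).2,
    fun l hl => tendsto_extendFrom (limits l hl).1,
    fun l hl => tendsto_extendFrom (limits l hl).2,
    fun t => jump_extend t (mem_contour.2 (Or.inl (ofReal_im t))) _ (.real t),
    fun i l hl => jump_extend l (mem_contour.2 (Or.inr (Or.inl ⟨i, hl⟩))) _ (.up i l hl),
    fun i l hl => jump_extend l (mem_contour.2 (Or.inr (Or.inr ⟨i, hl⟩))) _ (.down i l hl)⟩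

lemma exists_tendsto_conjGlue_dressed {ρ : Fin 2 → ℝ → ℂ} {A B : ℂ → Matrix (Fin 3) (Fin 3) ℂ}
    (hsep : IsSeparated z r) (hA : IsNormalized A) (hB : IsNormalized B)
    (jump_line : ∀ t : ℝ, A t = (B t).map conj *
      jumpReal (dressedReflection x z C ρ 0 t) (dressedReflection x z C ρ 1 t))
    {l : ℂ} {V : Matrix (Fin 3) (Fin 3) ℂ} (hV : IsJump x (ρ 0) (ρ 1) z r C l V) :
    ∃ a b,
      Tendsto (conjGlue (dressed x z r A (poleMap C)) (dressed x z r B (dualPoleMap C)))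
        (𝓝[plusSide z r] l) (𝓝 a) ∧
      Tendsto (conjGlue (dressed x z r A (poleMap C)) (dressed x z r B (dualPoleMap C)))
        (𝓝[minusSide z r] l) (𝓝 b) ∧ a = b * V := by
  have mem_contour_upper {l : ℂ} {i : Fin n} (hl : l ∈ Metric.sphere (z i) (r i)) :
      l ∈ contour z r ∧ 0 ≤ l.im :=
    ⟨mem_contour.2 (Or.inr (Or.inl ⟨i, hl⟩)), (im_pos_of_dist_le (hsep.radius_lt_im i) hl.le).le⟩
  cases hV with
  | real t =>
    have ht : (t : ℂ) ∈ contour z r ∧ 0 ≤ (t : ℂ).im := by simp [mem_contour]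
    have near_im_pos := eventually_im_pos_plusSide hsep ht.2
    refine ⟨_, _,
      tendsto_conjGlue_of_im_pos near_im_pos (hA.tendsto_dressed_plusSide hsep ht.1 ht.2),
      tendsto_conjGlue_of_im_neg near_im_pos ?_ (hB.tendsto_dressed_plusSide hsep ht.1 ht.2), ?_⟩
    · simpa only [conj_ofReal] using tendsto_conj_nhdsWithin_minusSide (z := z) (r := r) (l := t)
    · rw [jump_line, Matrix.mul_assoc, jumpReal_dressedReflection_mul, Matrix.map_mul,
        Matrix.mul_assoc]
  | up i _ hl =>
    obtain ⟨l_mem, l_im⟩ := mem_contour_upper hl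
    refine ⟨_, _, tendsto_conjGlue_of_im_pos (eventually_im_pos_plusSide hsep l_im)
      (hA.tendsto_dressed_plusSide hsep l_mem l_im), tendsto_conjGlue_of_im_pos
      (eventually_im_pos_minusSide hsep hl) (hA.tendsto_dressed_minusSide hsep hl), ?_⟩
    rw [expAd_jumpUp, Matrix.mul_assoc, one_add_poleMap_mul, sub_add_cancel]
  | down i _ hl =>
    have hl' : conj l ∈ Metric.sphere (z i) (r i) := by rwa [Metric.mem_sphere, dist_conj_left]
    obtain ⟨l_mem, l_im⟩ := mem_contour_upper hl'
    refine ⟨_, _, tendsto_conjGlue_of_im_neg (eventually_im_pos_minusSide hsep hl')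
      tendsto_conj_nhdsWithin_plusSide (hB.tendsto_dressed_minusSide hsep hl'),
      tendsto_conjGlue_of_im_neg (eventually_im_pos_plusSide hsep l_im)
      tendsto_conj_nhdsWithin_minusSide (hB.tendsto_dressed_plusSide hsep l_mem l_im), ?_⟩
    rw [expAd_jumpDown, Matrix.map_mul, Matrix.map_mul, Matrix.mul_assoc,
      one_add_dualPoleMap_map_conj, one_add_dualPoleMap_map_conj, ← Matrix.conjTranspose_mul,
      one_add_poleMap_mul, neg_sub, sub_eq_add_neg]

theorem exists_isSolution {ρ : Fin 2 → ℝ → ℂ} (hρ : ∀ k, IsRegular (ρ k)) (hsep : IsSeparated z r) :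
    ∃ M, IsSolution x (ρ 0) (ρ 1) z r C M := by
  have im_pos (i : Fin n) : 0 < (z i).im := (hsep.radius_pos i).trans (hsep.radius_lt_im i)
  obtain ⟨A, B, hA, hB, jump_line⟩ := exists_real_line
    (isRegular_dressedReflection (x := x) (C := C) hρ fun i => (im_pos i).ne')
  have upper := hA.isNormalizedOffCircles_dressed (x := x) (L := poleMap C) hsep
  have lower := hB.isNormalizedOffCircles_dressed (x := x) (L := dualPoleMap C) hsep
  exact ⟨_, isSolution_of_isJump hsep (differentiableOn_conjGlue upper lower)
    (tendsto_conjGlue_cobounded upper lower) (fun _ hδ => isBigO_conjGlue upper lower hδ)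
    fun _ _ => exists_tendsto_conjGlue_dressed hsep hA hB jump_line⟩

end Existence

end ManakovRHP

theorem mainTheorem7 (x : ℝ) (ρ₁ ρ₂ : ℝ → ℂ)
    (hρ₁ : ManakovRHP.MemH11 ρ₁) (hρ₂ : ManakovRHP.MemH11 ρ₂)
    (n : ℕ) (z : Fin n → ℂ) (r : Fin n → ℝ) (C : Fin n → Fin 2 → ℂ)
    (hr : ∀ i, 0 < r i) (hz : ∀ i, r i < (z i).im)
    (hd : ∀ i j, i ≠ j → r i + r j < dist (z i) (z j)) :
    ∃ M : ℂ → Matrix (Fin 3) (Fin 3) ℂ,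
      ManakovRHP.IsSolution x ρ₁ ρ₂ z r C M ∧
        ∀ M' : ℂ → Matrix (Fin 3) (Fin 3) ℂ, ManakovRHP.IsSolution x ρ₁ ρ₂ z r C M' →
          Set.EqOn M' M (ManakovRHP.contour z r)ᶜ := by
  have separated : ManakovRHP.IsSeparated z r := ⟨hr, hz, hd⟩
  have regular : ∀ k, ManakovRHP.IsRegular (![ρ₁, ρ₂] k) :=
    Fin.forall_fin_two.2 ⟨.of_memH11 hρ₁, .of_memH11 hρ₂⟩
  obtain ⟨M, hM⟩ := ManakovRHP.exists_isSolution (x := x) (C := C) regular separated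
  exact ⟨M, hM, fun _ hM' => hM.eqOn separated hM'⟩
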